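/- **Notation.** Write points of $\mathbb R\times\mathbb R^d$ ($d\ge1$) as $X=(t,x)$, $Y=(s,y)$, let $\delta(X,Y)=\max\{|x-y|,|t-s|^{1/2}\}$ and $Q_\rho(X)=\{Y:\delta(X,Y)<\rho\}$. For a set $S$ and a function $v$ on $S$ with values in a Banach space put $$[v]_{C^\kappa(S)}=\sup_{X\ne Y\in S}\frac{\|v(X)-v(Y)\|}{\delta(X,Y)^\kappa},\qquad \|v\|_{C^\kappa(S)}=\sup_S\|v\|+[v]_{C^\kappa(S)},$$ $$[v]^p_{\mathscr L^{p,\theta}(S)}=\sup_{X\in S,\ 0<\rho\le \operatorname{diam}S}\frac1{|S\cap Q_\rho(X)|^{\theta}}\int_{S\cap Q_\rho(X)}\|v(Y)-v_{X,\rho}\|^p\,dY,\qquad \|v\|_{\mathscr L^{p,\theta}(S)}^p=\|v\|_{L^p(S)}^p+[v]^p_{\mathscr L^{p,\theta}(S)},$$ where $v_{X,\rho}$ is the mean of $v$ over $S\cap Q_\rho(X)$ and the diameter is taken with respect to $\delta$. A function belongs to $C^\kappa(S)$ if $[v]_{C^\kappa(S)}<\infty$. When the values are random variables in $L^p(\Omega)$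 we write $C^\kappa(S;L^p(\Omega))$ and $\mathscr L^{p,\theta}(S;L^p(\Omega))$. **Theorem.** Let $T>0$ and let $D_T\subset\mathbb R\times\mathbb R^d$ be a bounded domain with $\overline{D_T}\subset(0,T)\times\mathbb R^d$ which is of $A$-type: for some $A>0$, $|D_T\cap Q_\rho(X)|\ge A|Q_\rho(X)|$ for all $X\in D_T$ and $0<\rho\le\operatorname{diam}D_T$. Let $0<\beta<1$, let $\gamma_1,\gamma_2>0$, and let $C_0,C_1\ge 0$ be constants. Let $K$ be a non-random measurable kernel such that for all $0\le s<t\le T$ $$\int_0^s\Big(\int_{\mathbb R^d}|K(t-r,z)-K(s-r,z)|(1+|z|^\beta)\,dz\Big)^2dr\le C_1(t-s)^{\gamma_1},$$ $$\int_0^s\Big(\int_{\mathbb R^d}|K(s-r,z)|\,dz\Big)^2dr\le C_0,\qquad \int_s^t\Big(\int_{\mathbb R^d}|K(t-r,z)|(1+|z|^\beta)\,dz\Big)^2dr\le C_1(t-s)^{\gamma_2}.$$ Let $g\in C^\beta(\mathbb R_+\times\mathbb R^d)$ be non-random with $g(0,0)=0$, let $W$ be a standard real Brownian motion, and let $$u(t,x)=\int_0^t\int_{\mathbb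 R^d}K(t-r,y)\,g(r,x-y)\,dy\,dW(r).$$ Let $p\ge1$, $\gamma=\min\{\gamma_1,\gamma_2,\beta\}$ and $\theta=1+\frac{\gamma p}{d+2}$. Then $u$ is well defined at every point of $D_T$, $u\in\mathscr L^{p,\theta}(D_T;L^p(\Omega))$, $u\in C^{\kappa}(D_T;L^p(\Omega))$ with finite norm for every $0<\kappa\le\gamma$, and $$\|u\|_{\mathscr L^{p,\theta}(D_T;L^p(\Omega))}\le C\|g\|_{C^\beta(\mathbb R_+\times\mathbb R^d)},\qquad \|u\|_{C^{\kappa}(D_T;L^p(\Omega))}\le C\|g\|_{C^\beta(\mathbb R_+\times\mathbb R^d)}\quad(0<\kappa\le\gamma);$$ in particular this holds with $\kappa=\beta$ if $\beta\le\min\{\gamma_1,\gamma_2\}$. Moreover, if $0<\delta<\gamma p/2$, $q>(d+2)/\delta$ and $0<r<q$, then, with $\beta^*=\gamma-2\delta/p$, the field $u$ has a modification $w$ on $D_T$ for which $\|w\|_{C^{\beta^*}(D_T)}$ is measurable in $\omega$ (up to null sets), $\big(\mathbb E\|w\|_{C^{\beta^*}(D_T)}^r\big)^{1/r}<\infty$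 and $$\big(\mathbb E\|w\|_{C^{\beta^*}(D_T)}^r\big)^{1/r}\le C'\|g\|_{C^\beta(\mathbb R_+\times\mathbb R^d)}.$$ The constant $C$ depends only on $d,T,D_T,\beta,\gamma_1,\gamma_2,C_0,C_1,p$, and $C'$ on these and $\delta,q,r$; neither depends on $g$, on the probability space or $W$, or on $K$ other than through $C_0,C_1,\gamma_1,\gamma_2$. -/

import Mathlib

open MeasureTheory ProbabilityTheory Filter Topology Set
open scoped ENNReal NNReal

noncomputable section

namespace StochHolder

/-- Points `X = (t, x)` of `ℝ × ℝ^d`, with the Euclidean norm on `ℝ^d`. -/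
abbrev SpaceTime (d : ℕ) : Type := ℝ × EuclideanSpace ℝ (Fin d)

variable {d : ℕ} {F : Type*} [NormedAddCommGroup F] [NormedSpace ℝ F]

/-- The parabolic distance `δ((t,x),(s,y)) = max {|x - y|, |t - s|^{1/2}}`. -/
def pdist (X Y : SpaceTime d) : ℝ := max ‖X.2 - Y.2‖ (Real.sqrt |X.1 - Y.1|)

/-- The parabolic ball `Q_ρ(X)`. -/
def pball (X : SpaceTime d) (ρ : ℝ) : Set (SpaceTime d) := {Y | pdist X Y < ρ}

/-- The diameter of a set with respect to the parabolic distance. -/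
def pdiam (S : Set (SpaceTime d)) : ℝ≥0∞ := ⨆ X ∈ S, ⨆ Y ∈ S, ENNReal.ofReal (pdist X Y)

/-- `S` is of `A`-type: `|S ∩ Q_ρ(X)| ≥ A |Q_ρ(X)|` for some `A > 0`, all `X ∈ S` and
all `0 < ρ ≤ diam S`. -/
def IsAType (S : Set (SpaceTime d)) : Prop :=
  ∃ A : ℝ≥0, 0 < A ∧ ∀ X ∈ S, ∀ ρ : ℝ, 0 < ρ → ENNReal.ofReal ρ ≤ pdiam S →
    A * volume (pball X ρ) ≤ volume (S ∩ pball X ρ)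

/-- The Hölder seminorm `[u]_{C^κ(S;δ)}` of a Banach-valued function, in `[0, ∞]`. -/
def holderSeminorm (κ : ℝ) (S : Set (SpaceTime d)) (u : SpaceTime d → F) : ℝ≥0∞ :=
  ⨆ X ∈ S, ⨆ Y ∈ S, ⨆ _ : X ≠ Y, ‖u X - u Y‖ₑ / ENNReal.ofReal (pdist X Y ^ κ)

/-- The Hölder norm `sup_S ‖u‖ + [u]_{C^κ(S;δ)}`, in `[0, ∞]`. -/
def holderNorm (κ : ℝ) (S : Set (SpaceTime d)) (u : SpaceTime d → F) : ℝ≥0∞ :=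
  (⨆ X ∈ S, ‖u X‖ₑ) + holderSeminorm κ S u

/-- The Campanato seminorm `[u]_{𝓛^{p,θ}(S;δ)}` of a Banach-valued function, in `[0, ∞]`. -/
def campanatoSeminorm (p θ : ℝ) (S : Set (SpaceTime d)) (u : SpaceTime d → F) : ℝ≥0∞ :=
  (⨆ X ∈ S, ⨆ ρ : ℝ, ⨆ _ : 0 < ρ ∧ ENNReal.ofReal ρ ≤ pdiam S,
    (∫⁻ Y in S ∩ pball X ρ, ‖u Y - ⨍ Z in S ∩ pball X ρ, u Z‖ₑ ^ p) /
      volume (S ∩ pball X ρ) ^ θ) ^ (1 / p)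

/-- The Campanato norm `(‖u‖_{L^p(S)}^p + [u]_{𝓛^{p,θ}(S;δ)}^p)^{1/p}`, in `[0, ∞]`. -/
def campanatoNorm (p θ : ℝ) (S : Set (SpaceTime d)) (u : SpaceTime d → F) : ℝ≥0∞ :=
  ((∫⁻ Y in S, ‖u Y‖ₑ ^ p) + campanatoSeminorm p θ S u ^ p) ^ (1 / p)

/-- Membership in the Campanato space `𝓛^{p,θ}(S;δ)`. -/
def MemCampanato (p θ : ℝ) (S : Set (SpaceTime d)) (u : SpaceTime d → F) : Prop :=
  AEStronglyMeasurable u (volume.restrict S) ∧ campanatoNorm p θ S u < ∞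

/-- The integral conditions on the kernel `K`, for all `0 ≤ s < t ≤ T`. -/
structure KernelBounds (T β γ₁ γ₂ : ℝ) (C₁ C₀ : ℝ≥0)
    (K : ℝ → EuclideanSpace ℝ (Fin d) → ℝ) : Prop where
  increment : ∀ s t : ℝ, 0 ≤ s → s < t → t ≤ T →
    ∫⁻ r in Ioo 0 s,
      (∫⁻ z, ‖K (t - r) z - K (s - r) z‖ₑ * ENNReal.ofReal (1 + ‖z‖ ^ β)) ^ 2
      ≤ C₁ * ENNReal.ofReal ((t - s) ^ γ₁)
  total : ∀ s t : ℝ, 0 ≤ s → s < t → t ≤ T →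
    ∫⁻ r in Ioo 0 s, (∫⁻ z, ‖K (s - r) z‖ₑ) ^ 2 ≤ C₀
  recent : ∀ s t : ℝ, 0 ≤ s → s < t → t ≤ T →
    ∫⁻ r in Ioo s t, (∫⁻ z, ‖K (t - r) z‖ₑ * ENNReal.ofReal (1 + ‖z‖ ^ β)) ^ 2
      ≤ C₁ * ENNReal.ofReal ((t - s) ^ γ₂)

variable {Ω : Type*} [MeasurableSpace Ω]

/-- The step function `∑ₜ cₜ 1_{(0,t]}` on `(0, ∞)`. -/
def stepFun (c : ℝ≥0 →₀ ℝ) (r : ℝ) : ℝ :=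
  c.sum fun t a => (Ioc (0 : ℝ) t).indicator (fun _ => a) r

/-- The elementary integral `∑ₜ cₜ W_t` of the step function `∑ₜ cₜ 1_{(0,t]}`; thus
`1_{(a,b]} = 1_{(0,b]} - 1_{(0,a]}` is sent to `W_b - W_a`. -/
def stepIntegral (W : ℝ≥0 → Ω → ℝ) (c : ℝ≥0 →₀ ℝ) (ω : Ω) : ℝ :=
  c.sum fun t a => a * W t ω

/-- `X` is (a version of) the Itô–Wiener integral `∫_0^∞ f dW` of the deterministic integrand
`f ∈ L²(0,∞)`: the `L²(Ω)`-limit of the elementary integrals of step functions that converge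
to `f` in `L²(0,∞)`. -/
def IsWienerIntegral (W : ℝ≥0 → Ω → ℝ) (P : Measure Ω) (f : ℝ → ℝ) (X : Ω → ℝ) : Prop :=
  MemLp f 2 (volume.restrict (Ioi (0 : ℝ))) ∧ MemLp X 2 P ∧
    ∃ c : ℕ → (ℝ≥0 →₀ ℝ),
      Tendsto (fun n => eLpNorm (fun r => f r - stepFun (c n) r) 2
        (volume.restrict (Ioi (0 : ℝ)))) atTop (𝓝 0) ∧
      Tendsto (fun n => eLpNorm (fun ω => X ω - stepIntegral W (c n) ω) 2 P) atTop (𝓝 0)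

open Classical in
/-- A version of the Itô–Wiener integral `∫_0^∞ f dW` (zero if there is none). -/
def wienerIntegral (W : ℝ≥0 → Ω → ℝ) (P : Measure Ω) (f : ℝ → ℝ) : Ω → ℝ :=
  if h : ∃ X, IsWienerIntegral W P f X then h.choose else 0

/-- The integrand `r ↦ 1_{(0,t)}(r) ∫ K(t-r,y) g(r,x-y) dy` of the stochastic convolution at
the point `X = (t,x)`. -/
def convIntegrand (K : ℝ → EuclideanSpace ℝ (Fin d) → ℝ) (g : SpaceTime d → ℝ)
    (X : SpaceTime d) : ℝ → ℝ :=
  (Ioo 0 X.1).indicator fun r => ∫ y, K (X.1 - r) y * g (r, X.2 - y)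

/-- The stochastic convolution `u(t,x) = ∫_0^t ∫ K(t-r,y) g(r,x-y) dy dW(r)`. -/
def stochConv (W : ℝ≥0 → Ω → ℝ) (P : Measure Ω) (K : ℝ → EuclideanSpace ℝ (Fin d) → ℝ)
    (g : SpaceTime d → ℝ) (X : SpaceTime d) : Ω → ℝ :=
  wienerIntegral W P (convIntegrand K g X)

/-- The defining integrals of the stochastic convolution at `X = (t,x)` exist: for almost every
`r ∈ (0,t)` the spatial integral converges absolutely, and the resulting integrand has an
Itô–Wiener integral, of which `stochConv W P K g X` is a version. -/
def StochConvExists (W : ℝ≥0 → Ω → ℝ) (P : Measure Ω)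
    (K : ℝ → EuclideanSpace ℝ (Fin d) → ℝ) (g : SpaceTime d → ℝ) (X : SpaceTime d) : Prop :=
  (∀ᵐ r ∂(volume.restrict (Ioo 0 X.1)), Integrable fun y => K (X.1 - r) y * g (r, X.2 - y)) ∧
    IsWienerIntegral W P (convIntegrand K g X) (stochConv W P K g X)

/-- The (quasi-)norm `(E ‖v‖_{C^κ(S)}^r)^{1/r}` of a random field `v` in `L^r(Ω; C^κ(S))`. -/
def lrHolderNorm (P : Measure Ω) (r κ : ℝ) (S : Set (SpaceTime d))
    (v : SpaceTime d → Ω → ℝ) : ℝ≥0∞ :=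
  (∫⁻ ω, holderNorm κ S (fun X => v X ω) ^ r ∂P) ^ (1 / r)

end StochHolder

end

open StochHolder

noncomputable section

namespace StochHolder

/-! ### Moments of centered Gaussian variables -/

section Gaussian

variable {Ω : Type*} [MeasurableSpace Ω] {P : Measure Ω}

/-! The field is Gaussian, so everything reduces to a deterministic `L²` estimate. The Wiener
integral is an isometry from `L²(0,∞)` onto a space of centered Gaussian variables, and for such
variables each `L^m`-norm is a fixed multiple of the `L²`-norm. Hence `u(X) - u(Y)` is bounded in
every `L^m(Ω)`, `m < ∞`, by the `L²(dr)`-norm of the difference of the two integrands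
(`IsWienerIntegral.sub`, `IsWienerIntegral.eLpNorm_le`).

For `X = (t,x)`, `Y = (s,y)` with `s ≤ t`, split the time axis at `s`. Before `s`, write the
difference as `(K(t-r,z) - K(s-r,z)) g(r,x-z) + K(s-r,z) (g(r,x-z) - g(r,y-z))`. As `g` vanishes at
the origin, `|g(r,x-z)|` is at most a constant times `1 + |z|^β`, and the increment condition
controls the first term; the second contains only a spatial increment of `g` and gains `|x-y|^β`.
After `s` only the recent part of the kernel remains. The squared norm is thus of order `(t-s)^γ₁ +
|x-y|^(2β) + (t-s)^γ₂`, and since `t-s ≤ δ(X,Y)²` this is at most a constant times `δ(X,Y)^(2γ)` on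
bounded sets (`eLpNorm_convIntegrand_sub_le`). Comparison with time `0`, where the field vanishes,
bounds `u` itself.

The `L^p(Ω)`-valued Hölder bounds follow at once. The Campanato bound follows from them, because the
oscillation on `Q_ρ` is at most a multiple of `ρ^γ` and the `A`-type condition turns `ρ^(γp)` into a
power of the volume (`campanato_quotient_le`).

The pathwise bound is Kolmogorov's theorem by chaining along parabolic dyadic grids
(`exists_holder_modification`). All moments being available, a crude count of grid pairs is enough:
a large exponent `m` is used, and then the norm is lowered to `L^r(Ω)`. -/

/-- The `L^m`-norm of a standard Gaussian variable. -/
def gaussNorm (m : ℝ≥0∞) : ℝ≥0∞ := eLpNorm id m (gaussianReal 0 1)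

lemma gaussNorm_lt_top {m : ℝ≥0∞} (hm : m ≠ ∞) : gaussNorm m < ∞ :=
  (memLp_id_gaussianReal' m hm).2

lemma gaussNorm_two : gaussNorm 2 = 1 := by
  have h := memLp_id_gaussianReal' (μ := 0) (v := 1) 2 (by simp)
  have h1 : ∫ x, (id x : ℝ) ^ 2 ∂(gaussianReal 0 1) = 1 := by
    have h2 := variance_eq_sub h
    rw [variance_id_gaussianReal] at h2
    simp only [id_eq, integral_id_gaussianReal] at h2
    simpa using h2.symm
  unfold gaussNorm
  rw [h.eLpNorm_eq_integral_rpow_norm (by simp) (by simp)]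
  have h3 : ∫ a, ‖(id a : ℝ)‖ ^ (2 : ℝ≥0∞).toReal ∂(gaussianReal 0 1) = 1 := by
    rw [← h1]
    refine integral_congr_ae (.of_forall fun x => ?_)
    simp
  rw [h3]
  simp

/-- In law, a centered Gaussian is `√v` times a standard one, so all its norms are multiples of
`√v`; the case `m = 2` identifies `√v`. -/
lemma eLpNorm_of_hasGaussianLaw {X : Ω → ℝ} (hX : HasGaussianLaw X P) (h0 : P[X] = 0)
    (m : ℝ≥0∞) : eLpNorm X m P = gaussNorm m * eLpNorm X 2 P := by
  have hmap := hX.map_eq_gaussianReal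
  rw [h0] at hmap
  set v := Var[X; P].toNNReal
  have hmap' : P.map X = (gaussianReal 0 1).map (√(v : ℝ) * ·) := by
    rw [hmap, gaussianReal_map_const_mul]
    congr 1
    · simp
    · ext; simp
  have key (m : ℝ≥0∞) : eLpNorm X m P = ‖√(v : ℝ)‖ₑ * gaussNorm m := by
    have h1 : eLpNorm X m P = eLpNorm id m (P.map X) := by
      rw [eLpNorm_map_measure (by fun_prop) hX.aemeasurable]; rfl
    rw [h1, hmap', eLpNorm_map_measure (by fun_prop) (by fun_prop), gaussNorm,
      ← eLpNorm_const_smul]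
    rfl
  rw [key m, key 2, gaussNorm_two, mul_one, mul_comm]

end Gaussian

/-! ### The Wiener integral -/

section Wiener

variable {Ω : Type*} [MeasurableSpace Ω] {P : Measure Ω} {W : ℝ≥0 → Ω → ℝ}

/-- The Hilbert space `L²(0,∞)`. -/
abbrev HalfLineL2 : Type := Lp ℝ 2 (volume.restrict (Ioi (0 : ℝ)))

lemma restrict_Ioi_Ioc_ne_top (t : ℝ) : volume.restrict (Ioi (0 : ℝ)) (Ioc 0 t) ≠ ∞ := by
  rw [Measure.restrict_apply measurableSet_Ioc]
  exact ((measure_mono inter_subset_left).trans_lt measure_Ioc_lt_top).ne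

/-- The class of `1_{(0,t]}` in `L²(0,∞)`. -/
def stepVec (t : ℝ≥0) : HalfLineL2 :=
  indicatorConstLp 2 (measurableSet_Ioc (a := (0 : ℝ)) (b := t)) (restrict_Ioi_Ioc_ne_top t) (1 : ℝ)

lemma inner_stepVec (s t : ℝ≥0) : inner ℝ (stepVec s) (stepVec t) = ((min s t : ℝ≥0) : ℝ) := by
  unfold stepVec
  rw [L2.real_inner_indicatorConstLp_one_indicatorConstLp_one _ _
    (restrict_Ioi_Ioc_ne_top s) (restrict_Ioi_Ioc_ne_top t)]
  have : Ioc (0 : ℝ) s ∩ Ioc 0 t = Ioc (0 : ℝ) ((min s t : ℝ≥0) : ℝ) := by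
    ext x; simp only [mem_inter_iff, mem_Ioc, NNReal.coe_min, le_min_iff]; tauto
  rw [this, measureReal_restrict_apply measurableSet_Ioc,
    inter_eq_left.2 (fun x hx => hx.1), Real.volume_real_Ioc_of_le (NNReal.coe_nonneg _), sub_zero]

lemma coeFn_finsuppSum {α ι : Type*} [MeasurableSpace α] {μ : Measure α}
    (e : ι → Lp ℝ 2 μ) (f : ι → α → ℝ) (h : ∀ i, e i =ᵐ[μ] f i) (c : ι →₀ ℝ) :
    (c.sum fun i a => a • e i : Lp ℝ 2 μ) =ᵐ[μ] fun x => c.sum fun i a => a * f i x := by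
  classical
  simp only [Finsupp.sum]
  have h1 := Lp.coeFn_finsetSum c.support (fun i => c i • e i)
  have h2 : ∀ᵐ x ∂μ, ∀ i ∈ c.support, (c i • e i : Lp ℝ 2 μ) x = c i * f i x := by
    rw [eventually_all_finset]
    intro i _
    filter_upwards [Lp.coeFn_smul (c i) (e i), h i] with x hx hx'
    rw [hx, Pi.smul_apply, hx', smul_eq_mul]
  filter_upwards [h1, h2] with x hx hx'
  rw [hx]
  simp only [Finset.sum_apply]
  exact Finset.sum_congr rfl hx'

lemma coeFn_sum_stepVec (c : ℝ≥0 →₀ ℝ) :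
    (c.sum fun t a => a • stepVec t : HalfLineL2)
      =ᵐ[volume.restrict (Ioi (0 : ℝ))] stepFun c := by
  refine (coeFn_finsuppSum stepVec (fun t => (Ioc (0 : ℝ) t).indicator fun _ => 1)
    (fun t => indicatorConstLp_coeFn) c).trans (.of_forall fun x => ?_)
  simp only [stepFun]
  refine Finsupp.sum_congr fun t _ => ?_
  by_cases hx : x ∈ Ioc (0 : ℝ) t <;> simp [hx]

/-- A function orthogonal to every `1_{(0,t]}` has vanishing primitive, and Lebesgue differentiation
then makes it zero almost everywhere. -/
lemma span_stepVec_dense : (Submodule.span ℝ (range stepVec)).topologicalClosure = ⊤ := by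
  rw [Submodule.topologicalClosure_eq_top_iff, Submodule.eq_bot_iff]
  intro f hf
  have h0 (t : ℝ≥0) : ∫ x in Ioc (0 : ℝ) t, f x = 0 := by
    have h1 := (Submodule.mem_orthogonal _ f).1 hf (stepVec t)
      (Submodule.subset_span (mem_range_self t))
    unfold stepVec at h1
    rw [L2.inner_indicatorConstLp_one] at h1
    rwa [Measure.restrict_restrict measurableSet_Ioc,
      inter_eq_left.2 (fun x hx => hx.1)] at h1
  set g : ℝ → ℝ := (Ioi (0 : ℝ)).indicator f
  have hg : LocallyIntegrable g volume := by
    have h1 : MemLp g 2 volume := (memLp_indicator_iff_restrict measurableSet_Ioi).2 (Lp.memLp f)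
    exact h1.locallyIntegrable (by norm_num)
  have hz (x : ℝ) (hx : 0 < x) : ∫ t in (0 : ℝ)..x, g t = 0 := by
    rw [intervalIntegral.integral_of_le hx.le]
    refine Eq.trans ?_ (h0 ⟨x, hx.le⟩)
    refine setIntegral_congr_fun measurableSet_Ioc fun y hy => ?_
    exact indicator_of_mem (s := Ioi (0 : ℝ)) hy.1 _
  have h2 := LocallyIntegrable.ae_hasDerivAt_integral hg
  rw [Lp.eq_zero_iff_ae_eq_zero, EventuallyEq, ae_restrict_iff' measurableSet_Ioi]
  filter_upwards [h2] with x hx hx0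
  have h3 : HasDerivAt (fun x => ∫ t in (0 : ℝ)..x, g t) 0 x := by
    refine (hasDerivAt_const x (0 : ℝ)).congr_of_eventuallyEq ?_
    exact eventually_of_mem (Ioi_mem_nhds (mem_Ioi.1 hx0)) fun y hy => (hz y hy)
  have h4 := (hx 0).unique h3
  rwa [show g x = f x from indicator_of_mem hx0 _] at h4

lemma memLp_brownian (hW : IsPreBrownianReal W P) (t : ℝ≥0) : MemLp (W t) 2 P :=
  (hW.isGaussianProcess.hasGaussianLaw_eval t).memLp_two

/-- The class of `W_t` in `L²(Ω)`. -/
def brownianVec (hW : IsPreBrownianReal W P) (t : ℝ≥0) : Lp ℝ 2 P :=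
  (memLp_brownian hW t).toLp _

lemma inner_brownianVec (hW : IsPreBrownianReal W P) (s t : ℝ≥0) :
    inner ℝ (brownianVec hW s) (brownianVec hW t) = ((min s t : ℝ≥0) : ℝ) := by
  have := hW.isGaussianProcess.isProbabilityMeasure
  have h1 := hW.covariance_eval s t
  rw [covariance_eq_sub (memLp_brownian hW s) (memLp_brownian hW t),
    hW.integral_eval, hW.integral_eval] at h1
  rw [L2.inner_def]
  simp only [mul_zero, sub_zero] at h1
  rw [← h1]
  refine integral_congr_ae ?_
  filter_upwards [(memLp_brownian hW s).coeFn_toLp, (memLp_brownian hW t).coeFn_toLp]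
    with ω h1 h2
  simp only [brownianVec, h1, h2, Pi.mul_apply]
  simp [mul_comm]

lemma coeFn_sum_brownianVec (hW : IsPreBrownianReal W P) (c : ℝ≥0 →₀ ℝ) :
    (c.sum fun t a => a • brownianVec hW t : Lp ℝ 2 P) =ᵐ[P] stepIntegral W c :=
  coeFn_finsuppSum (brownianVec hW) W (fun t => (memLp_brownian hW t).coeFn_toLp) c

/-- The norm of a linear combination depends only on the Gram matrix. Both `stepVec` and
`brownianVec` have Gram matrix `min s t`, which is the Itô isometry on step functions. -/
lemma norm_sum_eq_of_inner_eq {ι H₁ H₂ : Type*} [NormedAddCommGroup H₁] [InnerProductSpace ℝ H₁]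
    [NormedAddCommGroup H₂] [InnerProductSpace ℝ H₂] {e : ι → H₁} {e' : ι → H₂}
    (h : ∀ i j, inner ℝ (e i) (e j) = inner ℝ (e' i) (e' j)) (c : ι →₀ ℝ) :
    ‖c.sum fun i a => a • e i‖ = ‖c.sum fun i a => a • e' i‖ := by
  rw [← sq_eq_sq₀ (norm_nonneg _) (norm_nonneg _), ← real_inner_self_eq_norm_sq,
    ← real_inner_self_eq_norm_sq]
  simp only [Finsupp.sum, sum_inner, inner_sum, real_inner_smul_left, real_inner_smul_right, h]

lemma norm_sum_brownianVec (hW : IsPreBrownianReal W P) (c : ℝ≥0 →₀ ℝ) :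
    ‖c.sum fun t a => a • brownianVec hW t‖ = ‖c.sum fun t a => a • stepVec t‖ :=
  norm_sum_eq_of_inner_eq (fun s t => by rw [inner_brownianVec, inner_stepVec]) c

lemma memLp_stepIntegral (hW : IsPreBrownianReal W P) (c : ℝ≥0 →₀ ℝ) :
    MemLp (stepIntegral W c) 2 P :=
  (memLp_congr_ae (coeFn_sum_brownianVec hW c)).1 (Lp.memLp _)

lemma memLp_stepFun (c : ℝ≥0 →₀ ℝ) : MemLp (stepFun c) 2 (volume.restrict (Ioi (0 : ℝ))) :=
  (memLp_congr_ae (coeFn_sum_stepVec c)).1 (Lp.memLp _)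

lemma eLpNorm_stepIntegral_two (hW : IsPreBrownianReal W P) (c : ℝ≥0 →₀ ℝ) :
    eLpNorm (stepIntegral W c) 2 P = eLpNorm (stepFun c) 2 (volume.restrict (Ioi (0 : ℝ))) := by
  rw [← eLpNorm_congr_ae (coeFn_sum_brownianVec hW c), ← eLpNorm_congr_ae (coeFn_sum_stepVec c),
    ← Lp.enorm_def, ← Lp.enorm_def, ← ofReal_norm, ← ofReal_norm, norm_sum_brownianVec]

/-- A finite linear combination of the values of a Gaussian process is Gaussian, and it is centered
since each `W_t` is. -/
lemma eLpNorm_stepIntegral (hW : IsPreBrownianReal W P) (c : ℝ≥0 →₀ ℝ) (m : ℝ≥0∞) :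
    eLpNorm (stepIntegral W c) m P
      = gaussNorm m * eLpNorm (stepFun c) 2 (volume.restrict (Ioi (0 : ℝ))) := by
  rw [← eLpNorm_stepIntegral_two hW]
  refine eLpNorm_of_hasGaussianLaw ?_ ?_ m
  · exact (hW.isGaussianProcess.smul (fun t => c t)).hasGaussianLaw_fun_sum (I := c.support)
  · simp only [stepIntegral, Finsupp.sum]
    rw [integral_finsetSum _ fun i _ => (hW.integrable_eval i).const_mul _]
    refine Finset.sum_eq_zero fun i _ => ?_
    rw [integral_const_mul, hW.integral_eval, mul_zero]

/-- Approximate `f` by step functions; by the isometry their elementary integrals form a Cauchy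
sequence, whose limit is the integral. -/
theorem exists_isWienerIntegral (hW : IsPreBrownianReal W P) {f : ℝ → ℝ}
    (hf : MemLp f 2 (volume.restrict (Ioi (0 : ℝ)))) : ∃ X, IsWienerIntegral W P f X := by
  have hmem : hf.toLp f ∈ closure (Submodule.span ℝ (range stepVec) : Set HalfLineL2) := by
    rw [← Submodule.topologicalClosure_coe, span_stepVec_dense]; trivial
  obtain ⟨x, hx, hlim⟩ := mem_closure_iff_seq_limit.1 hmem
  choose c hc using fun n => Finsupp.mem_span_range_iff_exists_finsupp.1 (hx n)
  let y : ℕ → Lp ℝ 2 P := fun n => (c n).sum fun t a => a • brownianVec hW t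
  have hdist (m n : ℕ) : dist (y m) (y n) = dist (x m) (x n) := by
    have hsub {H : Type} [AddCommGroup H] [Module ℝ H] (e : ℝ≥0 → H) (c₁ c₂ : ℝ≥0 →₀ ℝ) :
        (c₁ - c₂).sum (fun t a => a • e t)
          = c₁.sum (fun t a => a • e t) - c₂.sum (fun t a => a • e t) :=
      Finsupp.sum_sub_index fun _ _ _ => sub_smul _ _ _
    -- The previous identity again, since `Lp ℝ 2 P` lives in the universe of `Ω`.
    have hsub' (c₁ c₂ : ℝ≥0 →₀ ℝ) :
        (c₁ - c₂).sum (fun t a => a • brownianVec hW t)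
          = c₁.sum (fun t a => a • brownianVec hW t) - c₂.sum (fun t a => a • brownianVec hW t) :=
      Finsupp.sum_sub_index fun _ _ _ => sub_smul _ _ _
    rw [dist_eq_norm, dist_eq_norm, ← hc m, ← hc n, ← hsub', ← hsub, norm_sum_brownianVec]
  have hcau : CauchySeq y := by
    have h1 := hlim.cauchySeq
    rw [Metric.cauchySeq_iff] at h1 ⊢
    simpa only [hdist] using h1
  obtain ⟨X, hX⟩ := cauchySeq_tendsto_of_complete hcau
  refine ⟨X, hf, Lp.memLp X, c, ?_, ?_⟩
  · have h1 := (Lp.tendsto_Lp_iff_tendsto_eLpNorm' _ _).1 hlim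
    refine h1.congr fun n => ?_
    rw [← hc n, eLpNorm_sub_comm]
    exact eLpNorm_congr_ae (hf.coeFn_toLp.sub (coeFn_sum_stepVec (c n)))
  · have h1 := (Lp.tendsto_Lp_iff_tendsto_eLpNorm' _ _).1 hX
    refine h1.congr fun n => ?_
    rw [eLpNorm_sub_comm]
    exact eLpNorm_congr_ae (EventuallyEq.rfl.sub (coeFn_sum_brownianVec hW (c n)))

theorem isWienerIntegral_wienerIntegral (hW : IsPreBrownianReal W P) {f : ℝ → ℝ}
    (hf : MemLp f 2 (volume.restrict (Ioi (0 : ℝ)))) :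
    IsWienerIntegral W P f (wienerIntegral W P f) := by
  have h := exists_isWienerIntegral hW hf
  rw [wienerIntegral, dif_pos h]
  exact h.choose_spec

/-- Versions are chosen separately for each integrand, so linearity is obtained by subtracting the
approximating step functions. -/
theorem IsWienerIntegral.sub (hW : IsPreBrownianReal W P) {f g : ℝ → ℝ} {X Y : Ω → ℝ}
    (hX : IsWienerIntegral W P f X) (hY : IsWienerIntegral W P g Y) :
    IsWienerIntegral W P (fun r => f r - g r) (fun ω => X ω - Y ω) := by
  obtain ⟨hf, hX2, c, hc, hcX⟩ := hX
  obtain ⟨hg, hY2, b, hb, hbY⟩ := hY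
  refine ⟨hf.sub hg, hX2.sub hY2, fun n => c n - b n, ?_, ?_⟩
  · refine tendsto_of_tendsto_of_tendsto_of_le_of_le tendsto_const_nhds
      (by simpa using hc.add hb) (fun _ => zero_le) fun n => ?_
    have h1 : (fun r => f r - g r - stepFun (c n - b n) r)
        = (fun r => f r - stepFun (c n) r) - fun r => g r - stepFun (b n) r := by
      ext r
      have : stepFun (c n - b n) r = stepFun (c n) r - stepFun (b n) r :=
        Finsupp.sum_sub_index fun t a b => by
          by_cases h : r ∈ Ioc (0 : ℝ) t <;> simp [h]
      simp only [this, Pi.sub_apply]; ring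
    rw [h1]
    exact eLpNorm_sub_le (hf.sub (memLp_stepFun _)).1 (hg.sub (memLp_stepFun _)).1 (by norm_num)
  · refine tendsto_of_tendsto_of_tendsto_of_le_of_le tendsto_const_nhds
      (by simpa using hcX.add hbY) (fun _ => zero_le) fun n => ?_
    have h1 : (fun ω => X ω - Y ω - stepIntegral W (c n - b n) ω)
        = (fun ω => X ω - stepIntegral W (c n) ω) - fun ω => Y ω - stepIntegral W (b n) ω := by
      ext r
      have : stepIntegral W (c n - b n) r = stepIntegral W (c n) r - stepIntegral W (b n) r :=
        Finsupp.sum_sub_index fun t a b => by ring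
      simp only [this, Pi.sub_apply]; ring
    rw [h1]
    exact eLpNorm_sub_le (hX2.sub (memLp_stepIntegral hW _)).1
      (hY2.sub (memLp_stepIntegral hW _)).1 (by norm_num)

/-- The approximation converges only in `L²(Ω)`, whereas `m` may exceed `2`. An almost surely
convergent subsequence and Fatou's lemma transfer the bound to the limit. -/
theorem IsWienerIntegral.eLpNorm_le (hW : IsPreBrownianReal W P) {f : ℝ → ℝ} {X : Ω → ℝ}
    (hX : IsWienerIntegral W P f X) {m : ℝ≥0∞} (hm : m ≠ ∞) :
    eLpNorm X m P ≤ gaussNorm m * eLpNorm f 2 (volume.restrict (Ioi (0 : ℝ))) := by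
  obtain ⟨hf, hX2, c, hc, hcX⟩ := hX
  have hmeas := tendstoInMeasure_of_tendsto_eLpNorm (f := fun n => stepIntegral W (c n)) (g := X)
    (μ := P) (l := atTop) (p := 2)
    (by norm_num) (fun n => (memLp_stepIntegral hW (c n)).1) hX2.1
    (hcX.congr fun n => eLpNorm_sub_comm _ _ _ _)
  obtain ⟨ns, hns, hae⟩ := hmeas.exists_seq_tendsto_ae
  refine (Lp.eLpNorm_lim_le_liminf_eLpNorm
    (fun n => (memLp_stepIntegral hW (c (ns n))).1) X hae).trans ?_
  simp only [eLpNorm_stepIntegral hW]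
  have hlim : Tendsto (fun n => gaussNorm m *
      (eLpNorm (fun r => f r - stepFun (c (ns n)) r) 2 (volume.restrict (Ioi (0 : ℝ)))
        + eLpNorm f 2 (volume.restrict (Ioi (0 : ℝ))))) atTop
      (𝓝 (gaussNorm m * eLpNorm f 2 (volume.restrict (Ioi (0 : ℝ))))) := by
    refine ENNReal.Tendsto.const_mul ?_ (Or.inr (gaussNorm_lt_top hm).ne)
    simpa using (hc.comp hns.tendsto_atTop).add_const (eLpNorm f 2 (volume.restrict (Ioi (0 : ℝ))))
  rw [← hlim.liminf_eq]
  refine liminf_le_liminf (.of_forall fun n => ?_)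
  gcongr
  have h1 : stepFun (c (ns n)) = f - (fun r => f r - stepFun (c (ns n)) r) := by
    ext r; simp
  conv_lhs => rw [h1]
  rw [add_comm]
  exact eLpNorm_sub_le hf.1 (hf.sub (memLp_stepFun _)).1 (by norm_num)

end Wiener

/-! ### The parabolic distance -/

section Parabolic

variable {d : ℕ} {F : Type*} [NormedAddCommGroup F]

lemma pdist_nonneg (X Y : SpaceTime d) : 0 ≤ pdist X Y := le_max_of_le_left (norm_nonneg _)

lemma pdist_self (X : SpaceTime d) : pdist X X = 0 := by simp [pdist]

lemma pdist_comm (X Y : SpaceTime d) : pdist X Y = pdist Y X := by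
  simp only [pdist, norm_sub_rev X.2 Y.2, abs_sub_comm X.1 Y.1]

lemma pdist_pos {X Y : SpaceTime d} (h : X ≠ Y) : 0 < pdist X Y := by
  rw [pdist, lt_max_iff]
  by_cases h2 : X.2 = Y.2
  · right
    have h1 : X.1 ≠ Y.1 := fun h1 => h (Prod.ext h1 h2)
    exact Real.sqrt_pos.2 (abs_pos.2 (sub_ne_zero.2 h1))
  · left
    exact norm_pos_iff.2 (sub_ne_zero.2 h2)

lemma sqrt_add_le_add_sqrt {a b : ℝ} (ha : 0 ≤ a) (hb : 0 ≤ b) : √(a + b) ≤ √a + √b := by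
  rw [Real.sqrt_le_left (by positivity)]
  nlinarith [Real.sq_sqrt ha, Real.sq_sqrt hb, Real.sqrt_nonneg a, Real.sqrt_nonneg b,
    mul_nonneg (Real.sqrt_nonneg a) (Real.sqrt_nonneg b)]

lemma pdist_triangle (X Y Z : SpaceTime d) : pdist X Z ≤ pdist X Y + pdist Y Z := by
  refine max_le ?_ ?_
  · exact (norm_sub_le_norm_sub_add_norm_sub _ Y.2 _).trans
      (add_le_add (le_max_left _ _) (le_max_left _ _))
  · calc √|X.1 - Z.1| ≤ √(|X.1 - Y.1| + |Y.1 - Z.1|) :=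
          Real.sqrt_le_sqrt (abs_sub_le _ _ _)
      _ ≤ √|X.1 - Y.1| + √|Y.1 - Z.1| := sqrt_add_le_add_sqrt (abs_nonneg _) (abs_nonneg _)
      _ ≤ _ := add_le_add (le_max_right _ _) (le_max_right _ _)

lemma continuous_pdist : Continuous fun p : SpaceTime d × SpaceTime d => pdist p.1 p.2 := by
  unfold pdist; fun_prop

lemma enorm_sub_le_holderSeminorm {κ : ℝ} {S : Set (SpaceTime d)} (g : SpaceTime d → F)
    {X Y : SpaceTime d} (hX : X ∈ S) (hY : Y ∈ S) :
    ‖g X - g Y‖ₑ ≤ holderSeminorm κ S g * ENNReal.ofReal (pdist X Y ^ κ) := by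
  by_cases h : X = Y
  · simp [h]
  have hp : 0 < pdist X Y ^ κ := Real.rpow_pos_of_pos (pdist_pos h) _
  rw [← ENNReal.div_le_iff (by simpa using hp) ENNReal.ofReal_ne_top]
  exact le_iSup₂_of_le X hX (le_iSup₂_of_le Y hY (le_iSup_of_le h le_rfl))

lemma holderSeminorm_le {κ : ℝ} {S : Set (SpaceTime d)} {g : SpaceTime d → F} {c : ℝ≥0∞}
    (h : ∀ X ∈ S, ∀ Y ∈ S, ‖g X - g Y‖ₑ ≤ c * ENNReal.ofReal (pdist X Y ^ κ)) :
    holderSeminorm κ S g ≤ c := by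
  refine iSup₂_le fun X hX => iSup₂_le fun Y hY => iSup_le fun hne => ?_
  have hp : 0 < pdist X Y ^ κ := Real.rpow_pos_of_pos (pdist_pos hne) _
  rw [ENNReal.div_le_iff (by simpa using hp) ENNReal.ofReal_ne_top]
  exact h X hX Y hY

lemma continuousOn_of_enorm_sub_le {κ : ℝ} (hκ : 0 < κ) {S : Set (SpaceTime d)}
    {g : SpaceTime d → F} {c : ℝ≥0∞} (hc : c ≠ ∞)
    (h : ∀ X ∈ S, ∀ Y ∈ S, ‖g X - g Y‖ₑ ≤ c * ENNReal.ofReal (pdist X Y ^ κ)) :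
    ContinuousOn g S := by
  intro X hX
  rw [ContinuousWithinAt, tendsto_iff_edist_tendsto_0]
  have hlim : Tendsto (fun Y => c * ENNReal.ofReal (pdist Y X ^ κ)) (𝓝[S] X) (𝓝 0) := by
    have h1 : Continuous fun Y => ENNReal.ofReal (pdist Y X ^ κ) :=
      ENNReal.continuous_ofReal.comp
        ((continuous_pdist.comp (by fun_prop : Continuous fun Y => (Y, X))).rpow_const
          fun _ => Or.inr hκ.le)
    have h2 := ENNReal.Tendsto.const_mul (a := c) (h1.continuousWithinAt (s := S) (x := X)).tendsto
      (Or.inr hc)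
    simpa [pdist_self, Real.zero_rpow hκ.ne'] using h2
  refine tendsto_of_tendsto_of_tendsto_of_le_of_le' tendsto_const_nhds hlim
    (.of_forall fun _ => zero_le) ?_
  filter_upwards [self_mem_nhdsWithin] with Y hY
  rw [edist_eq_enorm_sub]
  exact h Y hY X hX

/-- At bounded distances a higher power is dominated by a lower one. Because `R ≥ 1`, the constant
can be taken independent of the lower exponent. -/
lemma rpow_le_mul_rpow_of_le {ρ R γ a : ℝ} (h0 : 0 ≤ ρ) (hρ : ρ ≤ R) (hR : 1 ≤ R) (hγ : 0 < γ)
    (ha : γ ≤ a) : ρ ^ a ≤ R ^ a * ρ ^ γ := by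
  rcases h0.eq_or_lt with rfl | h0
  · rw [Real.zero_rpow (hγ.trans_le ha).ne', Real.zero_rpow hγ.ne', mul_zero]
  calc ρ ^ a = ρ ^ (a - γ) * ρ ^ γ := by rw [← Real.rpow_add h0]; simp
    _ ≤ R ^ a * ρ ^ γ := by
      gcongr
      exact (Real.rpow_le_rpow h0.le hρ (by linarith)).trans
        (Real.rpow_le_rpow_of_exponent_le hR (by linarith))

end Parabolic

/-! ### The integrand of the stochastic convolution -/

section Integrand

variable {d : ℕ} {K : ℝ → EuclideanSpace ℝ (Fin d) → ℝ} {g : SpaceTime d → ℝ}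
  {T β γ₁ γ₂ : ℝ} {C₁ C₀ : ℝ≥0} {N : ℝ}

/-- The half space `[0,∞) × ℝ^d`. -/
abbrev halfSpace (d : ℕ) : Set (SpaceTime d) := Ici 0 ×ˢ univ

/-- The cylinder `[0,T) × {|x| ≤ N}`. -/
abbrev cylinder (d : ℕ) (T N : ℝ) : Set (SpaceTime d) := {X | 0 ≤ X.1 ∧ X.1 < T ∧ ‖X.2‖ ≤ N}

/-- The weight `1 + |z|^β` as an extended nonnegative number. -/
def weight (d : ℕ) (β : ℝ) (z : EuclideanSpace ℝ (Fin d)) : ℝ≥0∞ := ENNReal.ofReal (1 + ‖z‖ ^ β)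

lemma measurable_weight : Measurable (weight d β) := by unfold weight; fun_prop

/-- The growth constant of Hölder functions vanishing at the origin. -/
def growthConst (T β N : ℝ) : ℝ≥0∞ := ENNReal.ofReal (1 + (N + √T) ^ β)

/-- Comparison with `g(0,0) = 0` and subadditivity of `s ↦ s^β` turn the Hölder seminorm into a
growth bound. This is where the weight `1 + |z|^β` in the kernel conditions comes from. -/
lemma enorm_le_growth (hβ0 : 0 < β) (hβ1 : β < 1) (hN : 0 ≤ N) (g0 : g (0, 0) = 0)
    {r : ℝ} (hr : 0 ≤ r) (hrT : r ≤ T) {x : EuclideanSpace ℝ (Fin d)} (hx : ‖x‖ ≤ N)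
    (z : EuclideanSpace ℝ (Fin d)) :
    ‖g (r, x - z)‖ₑ ≤ holderSeminorm β (halfSpace d) g * growthConst T β N * weight d β z := by
  have h := enorm_sub_le_holderSeminorm (κ := β) (S := halfSpace d) g
    (X := (r, x - z)) (Y := (0, 0)) ⟨hr, trivial⟩ ⟨self_mem_Ici, trivial⟩
  rw [g0, sub_zero] at h
  refine h.trans ?_
  rw [mul_assoc]
  gcongr
  rw [growthConst, weight, ← ENNReal.ofReal_mul (by positivity)]
  refine ENNReal.ofReal_le_ofReal ?_
  have h1 : pdist ((r, x - z) : SpaceTime d) (0, 0) ≤ (N + √T) + ‖z‖ := by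
    refine max_le ?_ ?_
    · simp only [sub_zero]
      linarith [norm_sub_le x z, Real.sqrt_nonneg T]
    · simp only [sub_zero, abs_of_nonneg hr]
      linarith [Real.sqrt_le_sqrt hrT, norm_nonneg z]
  have h2 : pdist ((r, x - z) : SpaceTime d) (0, 0) ^ β ≤ (N + √T) ^ β + ‖z‖ ^ β :=
    (Real.rpow_le_rpow (pdist_nonneg _ _) h1 hβ0.le).trans
      (Real.rpow_add_le_add_rpow (by positivity) (norm_nonneg z) hβ0.le hβ1.le)
  have h3 : 0 ≤ (N + √T) ^ β := by positivity
  have h4 : 0 ≤ ‖z‖ ^ β := by positivity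
  nlinarith

/-- The weighted spatial norm `∫ |K(t-r,z)| (1+|z|^β) dz`. -/
def kernelMass (β : ℝ) (K : ℝ → EuclideanSpace ℝ (Fin d) → ℝ) (t r : ℝ) : ℝ≥0∞ :=
  ∫⁻ z, ‖K (t - r) z‖ₑ * weight d β z

lemma measurable_kernel_slice (hK : Measurable (Function.uncurry K)) (t : ℝ) :
    Measurable fun p : ℝ × EuclideanSpace ℝ (Fin d) => K (t - p.1) p.2 :=
  hK.comp ((measurable_const.sub measurable_fst).prodMk measurable_snd)

lemma measurable_kernelMass (hK : Measurable (Function.uncurry K)) (t : ℝ) :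
    Measurable (kernelMass β K t) :=
  Measurable.lintegral_prod_right'
    (f := fun p : ℝ × EuclideanSpace ℝ (Fin d) => ‖K (t - p.1) p.2‖ₑ * weight d β p.2)
    ((measurable_kernel_slice hK t).enorm.mul (measurable_weight.comp measurable_snd))

lemma ae_kernelMass_lt_top (hK : Measurable (Function.uncurry K))
    (hKB : KernelBounds T β γ₁ γ₂ C₁ C₀ K) {t : ℝ} (ht : t ≤ T) :
    ∀ᵐ r ∂volume.restrict (Ioo 0 t), kernelMass β K t r < ∞ := by
  rcases le_or_gt t 0 with h0 | h0
  · simp [Ioo_eq_empty (not_lt.2 h0)]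
  -- With `s = 0` the recent part is the whole interval `(0,t)`, so the mass is square integrable
  -- there and finite almost everywhere.
  have h1 := hKB.recent 0 t le_rfl h0 ht
  have h2 := ae_lt_top' (μ := volume.restrict (Ioo 0 t))
    (((measurable_kernelMass (β := β) hK t).pow_const 2).aemeasurable)
    (h1.trans_lt (ENNReal.mul_lt_top ENNReal.coe_lt_top ENNReal.ofReal_lt_top)).ne
  filter_upwards [h2] with r hr
  by_contra h
  rw [not_lt, top_le_iff] at h
  simp [h] at hr

lemma lintegral_enorm_kernel_mul_le (hβ0 : 0 < β) (hβ1 : β < 1) (hN : 0 ≤ N)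
    (g0 : g (0, 0) = 0) {r : ℝ} (hr : 0 ≤ r) (hrT : r ≤ T) {x : EuclideanSpace ℝ (Fin d)}
    (hx : ‖x‖ ≤ N) {k : EuclideanSpace ℝ (Fin d) → ℝ} (hk : Measurable k) :
    ∫⁻ z, ‖k z * g (r, x - z)‖ₑ
      ≤ holderSeminorm β (halfSpace d) g * growthConst T β N * ∫⁻ z, ‖k z‖ₑ * weight d β z := by
  have hm : Measurable fun z => ‖k z‖ₑ * weight d β z := hk.enorm.mul measurable_weight
  rw [← lintegral_const_mul _ hm]
  refine lintegral_mono fun z => ?_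
  rw [enorm_mul, mul_left_comm]
  gcongr
  exact enorm_le_growth hβ0 hβ1 hN g0 hr hrT hx z

lemma growthConst_lt_top : growthConst T β N < ∞ := ENNReal.ofReal_lt_top

lemma measurable_kernel (hK : Measurable (Function.uncurry K)) (t : ℝ) : Measurable (K t) :=
  hK.comp measurable_prodMk_left

lemma ae_integrable_kernel_mul (hβ0 : 0 < β) (hβ1 : β < 1) (hN : 0 ≤ N)
    (hK : Measurable (Function.uncurry K)) (hKB : KernelBounds T β γ₁ γ₂ C₁ C₀ K)
    (hg : Measurable g) (g0 : g (0, 0) = 0) (hgH : holderSeminorm β (halfSpace d) g < ∞)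
    {t : ℝ} (ht : t ≤ T) {x : EuclideanSpace ℝ (Fin d)} (hx : ‖x‖ ≤ N) :
    ∀ᵐ r ∂volume.restrict (Ioo 0 t), Integrable fun z => K (t - r) z * g (r, x - z) := by
  filter_upwards [ae_kernelMass_lt_top hK hKB ht, ae_restrict_mem measurableSet_Ioo] with r hr hr'
  refine ⟨((measurable_kernel hK _).mul
    (hg.comp (measurable_const.prodMk (measurable_const.sub measurable_id)))).aestronglyMeasurable,
    ?_⟩
  exact (lintegral_enorm_kernel_mul_le hβ0 hβ1 hN g0 hr'.1.le (hr'.2.le.trans ht) hx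
    (measurable_kernel hK _)).trans_lt (ENNReal.mul_lt_top
      (ENNReal.mul_lt_top hgH growthConst_lt_top) hr)

lemma aestronglyMeasurable_convIntegrand (hK : Measurable (Function.uncurry K))
    (hg : Measurable g) (X : SpaceTime d) (μ : Measure ℝ) :
    AEStronglyMeasurable (convIntegrand K g X) μ := by
  refine (StronglyMeasurable.indicator ?_ measurableSet_Ioo).aestronglyMeasurable
  refine StronglyMeasurable.integral_prod_right'
    (f := fun p : ℝ × EuclideanSpace ℝ (Fin d) => K (X.1 - p.1) p.2 * g (p.1, X.2 - p.2)) ?_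
  exact ((measurable_kernel_slice hK X.1).mul (hg.comp
    (measurable_fst.prodMk (measurable_const.sub measurable_snd)))).stronglyMeasurable

lemma eLpNorm_two_le_of_lintegral_sq_le {α : Type*} [MeasurableSpace α] {μ : Measure α}
    {f : α → ℝ} {M : ℝ≥0∞} (h : ∫⁻ x, ‖f x‖ₑ ^ 2 ∂μ ≤ M ^ 2) : eLpNorm f 2 μ ≤ M := by
  rw [eLpNorm_eq_lintegral_rpow_enorm_toReal (by simp) (by simp)]
  simp only [ENNReal.toReal_ofNat, ENNReal.rpow_ofNat]
  calc (∫⁻ x, ‖f x‖ₑ ^ 2 ∂μ) ^ (1 / 2 : ℝ) ≤ (M ^ 2) ^ (1 / 2 : ℝ) := by gcongr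
    _ = M := by rw [← ENNReal.rpow_natCast, ← ENNReal.rpow_mul]; norm_num

lemma ennreal_add_sq_le (a b : ℝ≥0∞) : (a + b) ^ 2 ≤ 2 * a ^ 2 + 2 * b ^ 2 := by
  have := ENNReal.rpow_add_le_mul_rpow_add_rpow a b (p := 2) (by norm_num)
  norm_num at this
  rwa [mul_add] at this

/-- The squared `L²`-distance of two integrands, before simplification. -/
lemma lintegral_sq_convIntegrand_sub_le (hβ0 : 0 < β) (hβ1 : β < 1) (hN : 0 ≤ N)
    (hK : Measurable (Function.uncurry K)) (hKB : KernelBounds T β γ₁ γ₂ C₁ C₀ K)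
    (hg : Measurable g) (g0 : g (0, 0) = 0) (hgH : holderSeminorm β (halfSpace d) g < ∞)
    {t s : ℝ} (hs : 0 ≤ s) (hst : s ≤ t) (ht : t < T) {x y : EuclideanSpace ℝ (Fin d)}
    (hx : ‖x‖ ≤ N) (hy : ‖y‖ ≤ N) :
    ∫⁻ r in Ioi 0, ‖convIntegrand K g (t, x) r - convIntegrand K g (s, y) r‖ₑ ^ 2
      ≤ (2 * ((holderSeminorm β (halfSpace d) g * growthConst T β N) ^ 2
            * (C₁ * ENNReal.ofReal ((t - s) ^ γ₁)))
          + 2 * ((holderSeminorm β (halfSpace d) g * ENNReal.ofReal (‖x - y‖ ^ β)) ^ 2 * C₀))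
        + (holderSeminorm β (halfSpace d) g * growthConst T β N) ^ 2
            * (C₁ * ENNReal.ofReal ((t - s) ^ γ₂)) := by
  set H := holderSeminorm β (halfSpace d) g
  set M := H * growthConst T β N
  set F : ℝ → ℝ≥0∞ := fun r => ‖convIntegrand K g (t, x) r - convIntegrand K g (s, y) r‖ₑ ^ 2
  have hF0 : ∀ r, r ∉ Ioo 0 t → F r = 0 := by
    intro r hr
    have hr' : r ∉ Ioo 0 s := fun h => hr ⟨h.1, h.2.trans_le hst⟩
    simp [F, convIntegrand, hr, hr']
  have hsplit : ∫⁻ r in Ioi 0, F r ≤ (∫⁻ r in Ioo 0 s, F r) + ∫⁻ r in Ioo s t, F r := by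
    calc ∫⁻ r in Ioi 0, F r ≤ ∫⁻ r, F r := setLIntegral_le_lintegral _ _
      _ = ∫⁻ r in Ioo 0 t, F r := by
        rw [setLIntegral_eq_of_support_subset]
        intro r hr
        by_contra h
        exact hr (hF0 r h)
      _ ≤ ∫⁻ r in (Ioo 0 s ∪ Ioo s t) ∪ {s}, F r := by
        refine lintegral_mono_set fun r hr => ?_
        rcases lt_trichotomy r s with h | h | h
        · exact Or.inl (Or.inl ⟨hr.1, h⟩)
        · exact Or.inr h
        · exact Or.inl (Or.inr ⟨h, hr.2⟩)
      _ ≤ (∫⁻ r in Ioo 0 s ∪ Ioo s t, F r) + ∫⁻ r in {s}, F r := lintegral_union_le _ _ _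
      _ = ∫⁻ r in Ioo 0 s ∪ Ioo s t, F r := by simp
      _ ≤ _ := lintegral_union_le _ _ _
  refine hsplit.trans (add_le_add ?_ ?_)
  · -- the part before `s`
    set J : ℝ → ℝ≥0∞ := fun r => ∫⁻ z, ‖K (t - r) z - K (s - r) z‖ₑ * weight d β z
    set I : ℝ → ℝ≥0∞ := fun r => ∫⁻ z, ‖K (s - r) z‖ₑ
    have hJm : Measurable J := Measurable.lintegral_prod_right'
      (f := fun p : ℝ × EuclideanSpace ℝ (Fin d) =>
        ‖K (t - p.1) p.2 - K (s - p.1) p.2‖ₑ * weight d β p.2)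
      (((measurable_kernel_slice hK t).sub (measurable_kernel_slice hK s)).enorm.mul
        (measurable_weight.comp measurable_snd))
    have hIm : Measurable I := Measurable.lintegral_prod_right'
      (f := fun p : ℝ × EuclideanSpace ℝ (Fin d) => ‖K (s - p.1) p.2‖ₑ)
      (measurable_kernel_slice hK s).enorm
    have hJ : ∫⁻ r in Ioo 0 s, J r ^ 2 ≤ C₁ * ENNReal.ofReal ((t - s) ^ γ₁) := by
      rcases hst.eq_or_lt with rfl | h
      · simp [J]
      · exact hKB.increment s t hs h ht.le
    -- The condition asks for some time later than `s`; `t` may equal `s`, so `T` is used.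
    have hI : ∫⁻ r in Ioo 0 s, I r ^ 2 ≤ C₀ := hKB.total s T hs (hst.trans_lt ht) le_rfl
    have hpt : ∀ᵐ r ∂volume.restrict (Ioo 0 s),
        F r ≤ 2 * (M ^ 2 * J r ^ 2) + 2 * ((H * ENNReal.ofReal (‖x - y‖ ^ β)) ^ 2 * I r ^ 2) := by
      have h1 := ae_integrable_kernel_mul hβ0 hβ1 hN hK hKB hg g0 hgH ht.le hx
      have h1' := ae_restrict_of_ae_restrict_of_subset (Ioo_subset_Ioo_right hst) h1
      have h2 := ae_integrable_kernel_mul hβ0 hβ1 hN hK hKB hg g0 hgH (hst.trans ht.le) hy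
      filter_upwards [h1', h2, ae_restrict_mem measurableSet_Ioo] with r hr1 hr2 hr
      have hr' : r ∈ Ioo 0 t := ⟨hr.1, hr.2.trans_le hst⟩
      -- Add and subtract `K(s-r,z) g(r,x-z)`. The two values of `g` in the second term are taken at
      -- the same time `r`, so their parabolic distance is `|x-y|`.
      have hle : ‖convIntegrand K g (t, x) r - convIntegrand K g (s, y) r‖ₑ
          ≤ M * J r + H * ENNReal.ofReal (‖x - y‖ ^ β) * I r := by
        simp only [convIntegrand, indicator_of_mem hr, indicator_of_mem hr']
        rw [← integral_sub hr1 hr2]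
        refine (enorm_integral_le_lintegral_enorm _).trans ?_
        have hb := lintegral_enorm_kernel_mul_le (k := fun z => K (t - r) z - K (s - r) z)
          hβ0 hβ1 hN g0 hr.1.le (hr'.2.le.trans ht.le) hx
          ((measurable_kernel hK _).sub (measurable_kernel hK _))
        have hc : ∫⁻ z, ‖K (s - r) z * (g (r, x - z) - g (r, y - z))‖ₑ
            ≤ H * ENNReal.ofReal (‖x - y‖ ^ β) * I r := by
          rw [← lintegral_const_mul _ (measurable_kernel hK _).enorm]
          refine lintegral_mono fun z => ?_
          rw [enorm_mul, mul_comm]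
          gcongr
          refine (enorm_sub_le_holderSeminorm (κ := β) (S := halfSpace d) g
            (X := (r, x - z)) (Y := (r, y - z)) ⟨hr.1.le, trivial⟩ ⟨hr.1.le, trivial⟩).trans_eq ?_
          congr 3
          simp [pdist]
        refine le_trans ?_ (add_le_add hb hc)
        rw [← lintegral_add_left]
        · refine lintegral_mono fun z => ?_
          refine le_trans (le_of_eq ?_) (enorm_add_le _ _)
          congr 1
          ring
        · exact (((measurable_kernel hK _).sub (measurable_kernel hK _)).mul
            (hg.comp (measurable_const.prodMk (measurable_const.sub measurable_id)))).enorm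
      calc F r ≤ (M * J r + H * ENNReal.ofReal (‖x - y‖ ^ β) * I r) ^ 2 := by
            simp only [F]; gcongr
        _ ≤ _ := ennreal_add_sq_le _ _
        _ = _ := by simp only [mul_pow]
    refine (lintegral_mono_ae hpt).trans ?_
    rw [lintegral_add_left (by fun_prop), lintegral_const_mul _ (by fun_prop),
      lintegral_const_mul _ (by fun_prop), lintegral_const_mul _ (by fun_prop),
      lintegral_const_mul _ (by fun_prop)]
    gcongr
  · -- the part between `s` and `t`
    have hJ : ∫⁻ r in Ioo s t, kernelMass β K t r ^ 2 ≤ C₁ * ENNReal.ofReal ((t - s) ^ γ₂) := by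
      rcases hst.eq_or_lt with rfl | h
      · simp
      · exact hKB.recent s t hs h ht.le
    have hpt : ∀ r ∈ Ioo s t, F r ≤ M ^ 2 * kernelMass β K t r ^ 2 := by
      intro r hr
      have hr' : r ∈ Ioo 0 t := ⟨hs.trans_lt hr.1, hr.2⟩
      have hr'' : r ∉ Ioo 0 s := fun h => lt_asymm h.2 hr.1
      simp only [F, convIntegrand, indicator_of_mem hr', indicator_of_notMem hr'', sub_zero]
      rw [← mul_pow]
      gcongr
      refine (enorm_integral_le_lintegral_enorm _).trans ?_
      exact lintegral_enorm_kernel_mul_le hβ0 hβ1 hN g0 hr'.1.le (hr.2.le.trans ht.le) hx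
        (measurable_kernel hK _)
    refine (setLIntegral_mono' measurableSet_Ioo hpt).trans ?_
    rw [lintegral_const_mul _ ((measurable_kernelMass hK t).pow_const 2)]
    gcongr

lemma pdist_le_of_mem_cylinder {X Y : SpaceTime d} (hX : X ∈ cylinder d T N)
    (hY : Y ∈ cylinder d T N) : pdist X Y ≤ 1 + 2 * N + √T := by
  obtain ⟨h1, h2, h3⟩ := hX
  obtain ⟨h4, h5, h6⟩ := hY
  have hN : 0 ≤ N := (norm_nonneg _).trans h3
  refine max_le ?_ ?_
  · linarith [norm_sub_le X.2 Y.2, Real.sqrt_nonneg T]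
  · have : √|X.1 - Y.1| ≤ √T := Real.sqrt_le_sqrt (abs_le.2 ⟨by linarith, by linarith⟩)
    linarith

/-- Since `t - s ≤ δ²`, a squared norm of order `(t-s)^a` gives a norm of order `δ^a`: passing to
the parabolic distance compensates the square. -/
lemma sub_rpow_le_pdist {t s a : ℝ} (hst : s ≤ t) (x y : EuclideanSpace ℝ (Fin d)) (ha : 0 < a) :
    (t - s) ^ a ≤ (pdist (t, x) (s, y) ^ a) ^ 2 := by
  have h0 : 0 ≤ t - s := by linarith
  have h1 : √(t - s) ≤ pdist ((t, x) : SpaceTime d) (s, y) := by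
    refine le_max_of_le_right ?_
    simp [abs_of_nonneg h0]
  calc (t - s) ^ a = (√(t - s) ^ a) ^ 2 := by
        rw [← Real.rpow_natCast, ← Real.rpow_mul (Real.sqrt_nonneg _), mul_comm, Real.rpow_mul
          (Real.sqrt_nonneg _), Real.rpow_natCast, Real.sq_sqrt h0]
    _ ≤ _ := by gcongr

lemma convIntegrand_initial (x : EuclideanSpace ℝ (Fin d)) :
    convIntegrand K g (0, x) = 0 := by
  ext r
  simp [convIntegrand]

/-- The constant in the `L²`-estimate for the integrands. -/
def integrandConst (T β γ₁ γ₂ N : ℝ) (C₁ C₀ : ℝ≥0) : ℝ≥0∞ :=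
  2 * (growthConst T β N ^ 2 * (C₁ * ENNReal.ofReal ((1 + 2 * N + √T) ^ γ₁) ^ 2))
    + 2 * (ENNReal.ofReal ((1 + 2 * N + √T) ^ β) ^ 2 * C₀)
    + growthConst T β N ^ 2 * (C₁ * ENNReal.ofReal ((1 + 2 * N + √T) ^ γ₂) ^ 2) + 1

lemma integrandConst_lt_top : integrandConst T β γ₁ γ₂ N C₁ C₀ < ∞ := by
  have : growthConst T β N ≠ ∞ := growthConst_lt_top.ne
  unfold integrandConst
  finiteness

lemma eLpNorm_convIntegrand_sub_le {γ : ℝ} (hβ0 : 0 < β) (hβ1 : β < 1) (hN : 0 ≤ N)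
    (hK : Measurable (Function.uncurry K)) (hKB : KernelBounds T β γ₁ γ₂ C₁ C₀ K)
    (hg : Measurable g) (g0 : g (0, 0) = 0) (hgH : holderSeminorm β (halfSpace d) g < ∞)
    (hγ : 0 < γ) (h₁ : γ ≤ γ₁) (h₂ : γ ≤ γ₂) (h₃ : γ ≤ β)
    {X Y : SpaceTime d} (hX : X ∈ cylinder d T N) (hY : Y ∈ cylinder d T N) :
    eLpNorm (fun r => convIntegrand K g X r - convIntegrand K g Y r) 2
        (volume.restrict (Ioi (0 : ℝ)))
      ≤ integrandConst T β γ₁ γ₂ N C₁ C₀ * holderSeminorm β (halfSpace d) g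
        * ENNReal.ofReal (pdist X Y ^ γ) := by
  wlog hst : Y.1 ≤ X.1 generalizing X Y
  · rw [pdist_comm]
    refine le_trans (le_of_eq ?_) (this hY hX (le_of_not_ge hst))
    exact eLpNorm_sub_comm (convIntegrand K g X) (convIntegrand K g Y) _ _
  obtain ⟨t, x⟩ := X
  obtain ⟨s, y⟩ := Y
  refine eLpNorm_two_le_of_lintegral_sq_le ?_
  refine (lintegral_sq_convIntegrand_sub_le hβ0 hβ1 hN hK hKB hg g0 hgH hY.1 hst hX.2.1
    hX.2.2 hY.2.2).trans ?_
  set H := holderSeminorm β (halfSpace d) g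
  set R := 1 + 2 * N + √T
  set ρ := pdist ((t, x) : SpaceTime d) (s, y)
  have hR1 : 1 ≤ R := by have := Real.sqrt_nonneg T; simp only [R]; linarith
  have hρ0 : 0 ≤ ρ := pdist_nonneg _ _
  have hρR : ρ ≤ R := pdist_le_of_mem_cylinder hX hY
  have hpow {a : ℝ} (ha : γ ≤ a) :
      ENNReal.ofReal (ρ ^ a) ≤ ENNReal.ofReal (R ^ a) * ENNReal.ofReal (ρ ^ γ) := by
    rw [← ENNReal.ofReal_mul (by positivity)]
    exact ENNReal.ofReal_le_ofReal (rpow_le_mul_rpow_of_le hρ0 hρR hR1 hγ ha)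
  have htime {a : ℝ} (ha : γ ≤ a) : ENNReal.ofReal ((t - s) ^ a)
      ≤ ENNReal.ofReal (R ^ a) ^ 2 * ENNReal.ofReal (ρ ^ γ) ^ 2 := by
    rw [← mul_pow]
    refine le_trans ?_ (pow_le_pow_left' (hpow ha) 2)
    rw [← ENNReal.ofReal_pow (by positivity)]
    exact ENNReal.ofReal_le_ofReal (sub_rpow_le_pdist hst x y (hγ.trans_le ha))
  have hspace : ENNReal.ofReal (‖x - y‖ ^ β) ≤ ENNReal.ofReal (R ^ β) * ENNReal.ofReal (ρ ^ γ) := by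
    refine le_trans (ENNReal.ofReal_le_ofReal ?_) (hpow h₃)
    exact Real.rpow_le_rpow (norm_nonneg _) (le_max_left _ _) hβ0.le
  set A := integrandConst T β γ₁ γ₂ N C₁ C₀ with hA
  -- The summand `1` in `integrandConst` gives `A ≤ A²`, so `A` also serves after the square root is
  -- taken.
  have hA1 : 1 ≤ A := by rw [hA, integrandConst]; exact le_add_self
  calc _ ≤ (2 * ((H * growthConst T β N) ^ 2
            * (C₁ * (ENNReal.ofReal (R ^ γ₁) ^ 2 * ENNReal.ofReal (ρ ^ γ) ^ 2)))
          + 2 * ((H * (ENNReal.ofReal (R ^ β) * ENNReal.ofReal (ρ ^ γ))) ^ 2 * C₀))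
        + (H * growthConst T β N) ^ 2
            * (C₁ * (ENNReal.ofReal (R ^ γ₂) ^ 2 * ENNReal.ofReal (ρ ^ γ) ^ 2)) := by
        gcongr
        · exact htime h₁
        · exact htime h₂
    _ = (2 * (growthConst T β N ^ 2 * (C₁ * ENNReal.ofReal (R ^ γ₁) ^ 2))
          + 2 * (ENNReal.ofReal (R ^ β) ^ 2 * C₀)
          + growthConst T β N ^ 2 * (C₁ * ENNReal.ofReal (R ^ γ₂) ^ 2))
          * (H * ENNReal.ofReal (ρ ^ γ)) ^ 2 := by ring
    _ ≤ A * (H * ENNReal.ofReal (ρ ^ γ)) ^ 2 := by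
        gcongr
        exact le_self_add
    _ ≤ A ^ 2 * (H * ENNReal.ofReal (ρ ^ γ)) ^ 2 := by
        gcongr
        exact le_self_pow₀ hA1 (by norm_num)
    _ = _ := by ring

/-- The integrand vanishes at time `0`, so this is the increment bound between `X` and `(0, X.2)`.
-/
lemma eLpNorm_convIntegrand_le {γ : ℝ} (hβ0 : 0 < β) (hβ1 : β < 1) (hN : 0 ≤ N)
    (hK : Measurable (Function.uncurry K)) (hKB : KernelBounds T β γ₁ γ₂ C₁ C₀ K)
    (hg : Measurable g) (g0 : g (0, 0) = 0) (hgH : holderSeminorm β (halfSpace d) g < ∞)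
    (hγ : 0 < γ) (h₁ : γ ≤ γ₁) (h₂ : γ ≤ γ₂) (h₃ : γ ≤ β)
    {X : SpaceTime d} (hX : X ∈ cylinder d T N) :
    eLpNorm (convIntegrand K g X) 2 (volume.restrict (Ioi (0 : ℝ)))
      ≤ integrandConst T β γ₁ γ₂ N C₁ C₀ * holderSeminorm β (halfSpace d) g
        * ENNReal.ofReal ((1 + 2 * N + √T) ^ γ) := by
  have hY : ((0, X.2) : SpaceTime d) ∈ cylinder d T N := ⟨le_rfl, hX.1.trans_lt hX.2.1, hX.2.2⟩
  have h := eLpNorm_convIntegrand_sub_le hβ0 hβ1 hN hK hKB hg g0 hgH hγ h₁ h₂ h₃ hX hY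
  simp only [convIntegrand_initial, Pi.zero_apply, sub_zero] at h
  refine h.trans ?_
  gcongr
  · exact pdist_nonneg _ _
  · exact pdist_le_of_mem_cylinder hX hY

/-! ### Extension of the integrand by zero to negative times -/

/-- Only times in `(0,t)` enter. Nothing is known about `g` at negative times, but its extension by
zero from the half space is measurable. -/
lemma convIntegrand_indicator (X : SpaceTime d) :
    convIntegrand K ((halfSpace d).indicator g) X = convIntegrand K g X := by
  ext r
  by_cases hr : r ∈ Ioo 0 X.1
  · have h (y : EuclideanSpace ℝ (Fin d)) :
        (halfSpace d).indicator g (r, y) = g (r, y) :=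
      indicator_of_mem (show ((r, y) : SpaceTime d) ∈ halfSpace d from ⟨hr.1.le, trivial⟩) g
    simp only [convIntegrand, indicator_of_mem hr, h]
  · simp only [convIntegrand, indicator_of_notMem hr]

lemma holderSeminorm_congr {F : Type*} [NormedAddCommGroup F] {κ : ℝ} {S : Set (SpaceTime d)}
    {u v : SpaceTime d → F} (h : EqOn u v S) : holderSeminorm κ S u = holderSeminorm κ S v :=
  iSup_congr fun _ => iSup_congr fun hX => iSup_congr fun _ => iSup_congr fun hY => by
    rw [h hX, h hY]

lemma measurableSet_halfSpace : MeasurableSet (halfSpace d) :=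
  measurableSet_Ici.prod MeasurableSet.univ

lemma measurable_indicator_of_holder (hβ0 : 0 < β)
    (hgH : holderSeminorm β (halfSpace d) g < ∞) : Measurable ((halfSpace d).indicator g) := by
  classical
  have hc : ContinuousOn g (halfSpace d) := continuousOn_of_enorm_sub_le hβ0 hgH.ne
    fun X hX Y hY => enorm_sub_le_holderSeminorm g hX hY
  rw [← piecewise_eq_indicator]
  exact hc.measurable_piecewise continuousOn_const measurableSet_halfSpace

end Integrand

/-! ### From Hölder bounds to Hölder and Campanato norms -/

section Campanato

variable {d : ℕ} {F : Type*} [NormedAddCommGroup F]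

lemma isOpen_pball (X : SpaceTime d) (ρ : ℝ) : IsOpen (pball X ρ) :=
  (continuous_pdist.comp (Continuous.prodMk_right X)).isOpen_preimage _ (isOpen_Iio (a := ρ))

/-- The volume of the unit parabolic ball (a cylinder of height `2`). -/
def unitPballVolume (d : ℕ) : ℝ≥0∞ :=
  2 * volume (Metric.ball (0 : EuclideanSpace ℝ (Fin d)) 1)

lemma unitPballVolume_pos : 0 < unitPballVolume d :=
  ENNReal.mul_pos (by norm_num) (Metric.measure_ball_pos volume (0 : EuclideanSpace ℝ (Fin d)) one_pos).ne'

lemma unitPballVolume_lt_top : unitPballVolume d < ∞ :=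
  ENNReal.mul_lt_top (by norm_num) measure_ball_lt_top

/-- The ball contains a cylinder of height `2ρ²` over a Euclidean ball of radius `ρ`; hence the
homogeneous dimension `d + 2`. -/
lemma le_volume_pball (X : SpaceTime d) {ρ : ℝ} (hρ : 0 < ρ) :
    unitPballVolume d * ENNReal.ofReal (ρ ^ ((d : ℝ) + 2)) ≤ volume (pball X ρ) := by
  have hsub : Ioo (X.1 - ρ ^ 2) (X.1 + ρ ^ 2) ×ˢ Metric.ball X.2 ρ ⊆ pball X ρ := by
    rintro Y ⟨h1, h2⟩
    change max _ _ < ρ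
    refine max_lt ?_ ?_
    · rw [← dist_eq_norm, dist_comm]; exact h2
    · rw [Real.sqrt_lt' hρ, abs_lt]
      constructor <;> linarith [h1.1, h1.2]
  refine le_trans (le_of_eq ?_) (measure_mono hsub)
  rw [Measure.volume_eq_prod, Measure.prod_prod, Real.volume_Ioo, Measure.addHaar_ball_of_pos _ _ hρ,
    finrank_euclideanSpace, Fintype.card_fin, unitPballVolume,
    show X.1 + ρ ^ 2 - (X.1 - ρ ^ 2) = 2 * ρ ^ 2 by ring, ENNReal.ofReal_mul (by norm_num),
    Real.rpow_add hρ, Real.rpow_natCast, ENNReal.ofReal_mul (by positivity),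
    show ρ ^ (2 : ℝ) = ρ ^ 2 by norm_cast, ENNReal.ofReal_ofNat]
  ring

/-- The factor `R^γ` does not involve `κ`, so one constant serves every exponent `κ ≤ γ`. -/
lemma holderNorm_le_of_bounds {γ κ R : ℝ} {D : Set (SpaceTime d)} {v : SpaceTime d → F}
    {B : ℝ≥0∞} (hR : 1 ≤ R) (hDR : ∀ X ∈ D, ∀ Y ∈ D, pdist X Y ≤ R) (hκ : 0 < κ) (hκγ : κ ≤ γ)
    (h1 : ∀ X ∈ D, ‖v X‖ₑ ≤ B)
    (h2 : ∀ X ∈ D, ∀ Y ∈ D, ‖v X - v Y‖ₑ ≤ B * ENNReal.ofReal (pdist X Y ^ γ)) :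
    holderNorm κ D v ≤ B * (1 + ENNReal.ofReal (R ^ γ)) := by
  rw [mul_add, mul_one]
  refine add_le_add (iSup₂_le h1) (holderSeminorm_le fun X hX Y hY => (h2 X hX Y hY).trans ?_)
  rw [mul_assoc, ← ENNReal.ofReal_mul (by positivity)]
  gcongr
  exact rpow_le_mul_rpow_of_le (pdist_nonneg _ _) (hDR X hX Y hY) hR hκ hκγ

lemma integrableOn_of_bounds {γ : ℝ} (hγ : 0 < γ) {D Q : Set (SpaceTime d)}
    (hQ : MeasurableSet Q) (hQD : Q ⊆ D) (hvol : volume Q ≠ ∞) {v : SpaceTime d → F} {B : ℝ≥0∞}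
    (hB : B ≠ ∞) (h1 : ∀ X ∈ D, ‖v X‖ₑ ≤ B)
    (h2 : ∀ X ∈ D, ∀ Y ∈ D, ‖v X - v Y‖ₑ ≤ B * ENNReal.ofReal (pdist X Y ^ γ)) :
    IntegrableOn v Q := by
  refine ⟨((continuousOn_of_enorm_sub_le hγ hB h2).mono hQD).aestronglyMeasurable hQ, ?_⟩
  refine (setLIntegral_mono' hQ fun X hX => h1 X (hQD hX)).trans_lt ?_
  rw [setLIntegral_const]
  exact ENNReal.mul_lt_top hB.lt_top hvol.lt_top

variable [NormedSpace ℝ F] [CompleteSpace F]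

/-- A closed ball is convex, so it contains the mean of values lying in it. -/
lemma enorm_sub_setAverage_le {α : Type*} [MeasurableSpace α] {μ : Measure α} {Q : Set α}
    (hQ : MeasurableSet Q) (h0 : μ Q ≠ 0) (htop : μ Q ≠ ∞) {v : α → F}
    (hv : IntegrableOn v Q μ) {y : α} {M : ℝ≥0∞} (hM : M ≠ ∞)
    (h : ∀ z ∈ Q, ‖v y - v z‖ₑ ≤ M) : ‖v y - ⨍ z in Q, v z ∂μ‖ₑ ≤ M := by
  have hmem : ⨍ z in Q, v z ∂μ ∈ Metric.closedBall (v y) M.toReal := by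
    refine (convex_closedBall _ _).set_average_mem Metric.isClosed_closedBall h0 htop ?_ hv
    refine ae_restrict_of_forall_mem hQ fun z hz => ?_
    rw [Metric.mem_closedBall, dist_comm, dist_eq_norm, ← toReal_enorm]
    exact ENNReal.toReal_mono hM (h z hz)
  rw [Metric.mem_closedBall, dist_comm, dist_eq_norm, ← toReal_enorm] at hmem
  exact (ENNReal.toReal_le_toReal enorm_ne_top hM).1 hmem

/-- The constant comparing the Campanato seminorm with the Hölder bound. -/
def campanatoConst (d : ℕ) (p γ : ℝ) (A : ℝ≥0) : ℝ≥0∞ :=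
  ENNReal.ofReal (2 ^ (γ * p)) * (A * unitPballVolume d) ^ (-(γ * p / (d + 2)))

lemma campanatoConst_lt_top {p γ : ℝ} {A : ℝ≥0} (hA : 0 < A) : campanatoConst d p γ A < ∞ := by
  have h1 : (A : ℝ≥0∞) * unitPballVolume d ≠ 0 :=
    mul_ne_zero (by exact_mod_cast hA.ne') unitPballVolume_pos.ne'
  have h2 : (A : ℝ≥0∞) * unitPballVolume d ≠ ∞ :=
    ENNReal.mul_ne_top ENNReal.coe_ne_top unitPballVolume_lt_top.ne
  exact ENNReal.mul_lt_top ENNReal.ofReal_lt_top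
    (ENNReal.rpow_ne_top_of_ne_zero h1 h2).lt_top

/-- The oscillation of `v` on `Q` is at most `B (2ρ)^γ`, so the integral is at most `B^p (2ρ)^(γp)
|Q|`. By the lower volume bound, `ρ^(γp)` is at most a multiple of `|Q|^(γp/(d+2))`, which explains
the exponent `θ`. -/
lemma campanato_quotient_le {γ p : ℝ} (hγ : 0 < γ) (hp : 1 ≤ p) {D : Set (SpaceTime d)}
    (hDo : IsOpen D) (hvol : volume D ≠ ∞) {A : ℝ≥0} (hA : 0 < A)
    {v : SpaceTime d → F} {B : ℝ≥0∞} (hB : B ≠ ∞) (h1 : ∀ X ∈ D, ‖v X‖ₑ ≤ B)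
    (h2 : ∀ X ∈ D, ∀ Y ∈ D, ‖v X - v Y‖ₑ ≤ B * ENNReal.ofReal (pdist X Y ^ γ))
    {X : SpaceTime d} {ρ : ℝ} (hρ : 0 < ρ)
    (hAX : A * volume (pball X ρ) ≤ volume (D ∩ pball X ρ)) :
    (∫⁻ Y in D ∩ pball X ρ, ‖v Y - ⨍ Z in D ∩ pball X ρ, v Z‖ₑ ^ p) /
      volume (D ∩ pball X ρ) ^ (1 + γ * p / (d + 2)) ≤ B ^ p * campanatoConst d p γ A := by
  set Q := D ∩ pball X ρ
  set V := volume Q with hV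
  have hQm : MeasurableSet Q := (hDo.inter (isOpen_pball X ρ)).measurableSet
  have hVtop : V ≠ ∞ := ((measure_mono inter_subset_left).trans_lt hvol.lt_top).ne
  set a : ℝ≥0∞ := A * unitPballVolume d with ha
  have ha0 : a ≠ 0 := mul_ne_zero (by exact_mod_cast hA.ne') unitPballVolume_pos.ne'
  have hatop : a ≠ ∞ := ENNReal.mul_ne_top ENNReal.coe_ne_top unitPballVolume_lt_top.ne
  have hVa : a * ENNReal.ofReal (ρ ^ ((d : ℝ) + 2)) ≤ V := by
    refine le_trans ?_ hAX
    rw [ha, mul_assoc]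
    gcongr
    exact le_volume_pball X hρ
  have hV0 : V ≠ 0 := by
    refine (lt_of_lt_of_le (ENNReal.mul_pos ha0 ?_) hVa).ne'
    simpa using Real.rpow_pos_of_pos hρ _
  have hint : IntegrableOn v Q :=
    integrableOn_of_bounds hγ hQm inter_subset_left hVtop hB h1 h2
  have hosc : ∀ Y ∈ Q, ‖v Y - ⨍ Z in Q, v Z‖ₑ ≤ B * ENNReal.ofReal ((2 * ρ) ^ γ) := by
    intro Y hY
    refine enorm_sub_setAverage_le hQm hV0 hVtop hint
      (ENNReal.mul_ne_top hB ENNReal.ofReal_ne_top) fun Z hZ => ?_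
    refine (h2 Y hY.1 Z hZ.1).trans ?_
    gcongr
    · exact pdist_nonneg _ _
    · have h3 : pdist X Y < ρ := hY.2
      have h4 : pdist X Z < ρ := hZ.2
      have := pdist_triangle Y X Z
      rw [pdist_comm Y X] at this
      linarith
  have hp0 : 0 ≤ p := by linarith
  set e : ℝ := γ * p / (d + 2) with he
  have hd2 : (0 : ℝ) < d + 2 := by positivity
  have he0 : 0 ≤ e := by positivity
  refine ENNReal.div_le_of_le_mul ?_
  calc ∫⁻ Y in Q, ‖v Y - ⨍ Z in Q, v Z‖ₑ ^ p
      ≤ ∫⁻ _ in Q, (B * ENNReal.ofReal ((2 * ρ) ^ γ)) ^ p :=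
        setLIntegral_mono' hQm fun Y hY => ENNReal.rpow_le_rpow (hosc Y hY) hp0
    _ = B ^ p * (ENNReal.ofReal (2 ^ (γ * p)) * ENNReal.ofReal (ρ ^ (γ * p))) * V := by
        rw [setLIntegral_const, ENNReal.mul_rpow_of_nonneg _ _ hp0,
          ENNReal.ofReal_rpow_of_nonneg (by positivity) hp0, ← Real.rpow_mul (by positivity),
          Real.mul_rpow (by norm_num) hρ.le, ENNReal.ofReal_mul (by positivity)]
    _ = B ^ p * (ENNReal.ofReal (2 ^ (γ * p)) * (a ^ (-e) * a ^ e) *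
          ENNReal.ofReal (ρ ^ (γ * p))) * V := by
        rw [← ENNReal.rpow_add _ _ ha0 hatop]; simp
    _ = B ^ p * (ENNReal.ofReal (2 ^ (γ * p)) * a ^ (-e)) *
          (V * (a * ENNReal.ofReal (ρ ^ ((d : ℝ) + 2))) ^ e) := by
        rw [ENNReal.mul_rpow_of_nonneg a _ he0, ENNReal.ofReal_rpow_of_nonneg (by positivity) he0,
          ← Real.rpow_mul hρ.le, show ((d : ℝ) + 2) * e = γ * p by rw [he]; field_simp]
        ring
    _ ≤ B ^ p * campanatoConst d p γ A * V ^ (1 + e) := by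
        rw [ENNReal.rpow_add _ _ hV0 hVtop, ENNReal.rpow_one]
        unfold campanatoConst
        gcongr

lemma campanatoNorm_le_of_bounds {γ p : ℝ} (hγ : 0 < γ) (hp : 1 ≤ p) {D : Set (SpaceTime d)}
    (hDo : IsOpen D) (hvol : volume D ≠ ∞) {A : ℝ≥0} (hA : 0 < A)
    (hDA : ∀ X ∈ D, ∀ ρ : ℝ, 0 < ρ → ENNReal.ofReal ρ ≤ pdiam D →
      A * volume (pball X ρ) ≤ volume (D ∩ pball X ρ))
    {v : SpaceTime d → F} {B : ℝ≥0∞} (hB : B ≠ ∞) (h1 : ∀ X ∈ D, ‖v X‖ₑ ≤ B)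
    (h2 : ∀ X ∈ D, ∀ Y ∈ D, ‖v X - v Y‖ₑ ≤ B * ENNReal.ofReal (pdist X Y ^ γ)) :
    campanatoNorm p (1 + γ * p / (d + 2)) D v
      ≤ B * (volume D + campanatoConst d p γ A) ^ (1 / p) := by
  have hp0 : 0 < p := by linarith
  have hroot (x : ℝ≥0∞) : (x ^ (1 / p)) ^ p = x := by
    rw [← ENNReal.rpow_mul, one_div, inv_mul_cancel₀ hp0.ne', ENNReal.rpow_one]
  have hroot' (x : ℝ≥0∞) : (x ^ p) ^ (1 / p) = x := by
    rw [← ENNReal.rpow_mul, one_div, mul_inv_cancel₀ hp0.ne', ENNReal.rpow_one]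
  have hsemi : campanatoSeminorm p (1 + γ * p / (d + 2)) D v ^ p
      ≤ B ^ p * campanatoConst d p γ A := by
    rw [campanatoSeminorm, hroot]
    exact iSup₂_le fun X hX => iSup₂_le fun ρ hρ =>
      campanato_quotient_le hγ hp hDo hvol hA hB h1 h2 hρ.1 (hDA X hX ρ hρ.1 hρ.2)
  have hLp : ∫⁻ Y in D, ‖v Y‖ₑ ^ p ≤ B ^ p * volume D := by
    rw [← setLIntegral_const]
    exact setLIntegral_mono' hDo.measurableSet fun Y hY => ENNReal.rpow_le_rpow (h1 Y hY) hp0.le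
  calc campanatoNorm p (1 + γ * p / (d + 2)) D v
      ≤ (B ^ p * volume D + B ^ p * campanatoConst d p γ A) ^ (1 / p) :=
        ENNReal.rpow_le_rpow (add_le_add hLp hsemi) (by positivity)
    _ = _ := by rw [← mul_add, ENNReal.mul_rpow_of_nonneg _ _ (by positivity), hroot']

end Campanato

/-! ### Dyadic approximation in the parabolic distance -/

section Nets

variable {d : ℕ} {T N : ℝ}

/-- The parabolic dyadic grid point `(4⁻ⁿ i, 2⁻ⁿ j)`. -/
def gridPoint (d n : ℕ) (i : ℤ × (Fin d → ℤ)) : SpaceTime d :=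
  ((i.1 : ℝ) / 4 ^ n, WithLp.toLp 2 fun k => (i.2 k : ℝ) / 2 ^ n)

/-- The index of the dyadic cell that contains `X`. -/
def gridIndex (n : ℕ) (X : SpaceTime d) : ℤ × (Fin d → ℤ) :=
  (⌊X.1 * 4 ^ n⌋, fun k => ⌊X.2 k * 2 ^ n⌋)

/-- The lower corner of the parabolic dyadic cell of generation `n` that contains `X`. -/
def gridProj (n : ℕ) (X : SpaceTime d) : SpaceTime d := gridPoint d n (gridIndex n X)

lemma floor_div_bounds (a : ℝ) {b : ℝ} (hb : 0 < b) :
    (⌊a * b⌋ : ℝ) / b ≤ a ∧ a - (⌊a * b⌋ : ℝ) / b ≤ 1 / b := by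
  constructor
  · rw [div_le_iff₀ hb]; exact Int.floor_le _
  · rw [sub_le_iff_le_add, ← add_div, le_div_iff₀ hb]
    linarith [Int.lt_floor_add_one (a * b)]

lemma norm_le_of_coord_le {x : EuclideanSpace ℝ (Fin d)} {c : ℝ} (hc : 0 ≤ c)
    (h : ∀ k, |x k| ≤ c) : ‖x‖ ≤ d * c := by
  rw [EuclideanSpace.norm_eq, Real.sqrt_le_left (by positivity)]
  calc ∑ i, ‖x i‖ ^ 2 ≤ ∑ _i : Fin d, c ^ 2 := by
        gcongr with i
        exact h i
    _ = d * c ^ 2 := by simp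
    _ ≤ (d * c) ^ 2 := by
        rw [mul_pow]
        gcongr
        exact_mod_cast Nat.le_self_pow two_ne_zero d

lemma norm_snd_sub_gridProj_le (n : ℕ) (X : SpaceTime d) :
    ‖X.2 - (gridProj n X).2‖ ≤ d * (1 / 2) ^ n := by
  refine norm_le_of_coord_le (by positivity) fun k => ?_
  have h := floor_div_bounds (X.2 k) (b := 2 ^ n) (by positivity)
  have h2 : (X.2 - (gridProj n X).2) k = X.2 k - (⌊X.2 k * 2 ^ n⌋ : ℝ) / 2 ^ n := rfl
  rw [h2, one_div_pow, abs_of_nonneg (by linarith [h.1])]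
  exact h.2

lemma pdist_gridProj_le (n : ℕ) (X : SpaceTime d) :
    pdist X (gridProj n X) ≤ (d + 1) * (1 / 2) ^ n := by
  refine max_le ?_ ?_
  · refine (norm_snd_sub_gridProj_le n X).trans ?_
    gcongr
    linarith
  · have h := floor_div_bounds X.1 (b := 4 ^ n) (by positivity)
    have h2 : X.1 - (gridProj n X).1 = X.1 - (⌊X.1 * 4 ^ n⌋ : ℝ) / 4 ^ n := rfl
    rw [h2, abs_of_nonneg (by linarith [h.1]), Real.sqrt_le_left (by positivity)]
    refine h.2.trans ?_
    have h4 : (1 : ℝ) / 4 ^ n = ((1 / 2) ^ n) ^ 2 := by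
      rw [← pow_mul, mul_comm n 2, pow_mul, ← one_div_pow]; norm_num
    rw [h4]
    gcongr
    have : (0 : ℝ) ≤ d := by positivity
    nlinarith [pow_pos (by norm_num : (0 : ℝ) < 1 / 2) n]

/-- Rounding down keeps the time in `[0,T)` but can move the space variable by up to `d`; moment
bounds are therefore needed on the cylinder of radius `N + d`. -/
lemma gridProj_mem_cylinder (n : ℕ) {X : SpaceTime d} (hX : X ∈ cylinder d T N) :
    gridProj n X ∈ cylinder d T (N + d) := by
  obtain ⟨h0, hT, hN⟩ := hX
  have h := floor_div_bounds X.1 (b := 4 ^ n) (by positivity)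
  refine ⟨?_, h.1.trans_lt hT, ?_⟩
  · have : (0 : ℝ) ≤ ⌊X.1 * 4 ^ n⌋ := by exact_mod_cast Int.floor_nonneg.2 (by positivity)
    exact div_nonneg this (by positivity)
  · have h1 := norm_snd_sub_gridProj_le n X
    have h2 : (d : ℝ) * (1 / 2) ^ n ≤ d := by
      have : ((1 : ℝ) / 2) ^ n ≤ 1 := pow_le_one₀ (by norm_num) (by norm_num)
      nlinarith [(by positivity : (0 : ℝ) ≤ d)]
    have h3 := norm_le_norm_add_norm_sub X.2 (gridProj n X).2
    linarith

/-- The indices of the cells of generation `n` that meet the cylinder. -/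
def gridBox (d : ℕ) (T N : ℝ) (n : ℕ) : Finset (ℤ × (Fin d → ℤ)) :=
  Finset.Icc 0 (⌈T⌉₊ * 4 ^ n : ℤ) ×ˢ
    Fintype.piFinset fun _ => Finset.Icc (-(⌈N⌉₊ * 2 ^ n : ℤ)) (⌈N⌉₊ * 2 ^ n : ℤ)

lemma gridIndex_mem_gridBox (n : ℕ) {X : SpaceTime d} (hX : X ∈ cylinder d T N) :
    gridIndex n X ∈ gridBox d T N n := by
  obtain ⟨h0, hT, hN⟩ := hX
  simp only [gridBox, gridIndex, Finset.mem_product, Finset.mem_Icc, Fintype.mem_piFinset]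
  refine ⟨⟨Int.floor_nonneg.2 (by positivity), ?_⟩, fun k => ⟨?_, ?_⟩⟩
  · rw [← Int.cast_le (R := ℝ)]
    refine (Int.floor_le _).trans ?_
    push_cast
    gcongr
    exact hT.le.trans (Nat.le_ceil T)
  · rw [Int.le_floor]
    push_cast
    rw [← neg_mul]
    gcongr
    have := (PiLp.norm_apply_le X.2 k).trans (hN.trans (Nat.le_ceil N))
    exact (abs_le.1 this).1
  · rw [← Int.cast_le (R := ℝ)]
    refine (Int.floor_le _).trans ?_
    push_cast
    gcongr
    have := (PiLp.norm_apply_le X.2 k).trans (hN.trans (Nat.le_ceil N))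
    exact (abs_le.1 this).2

/-- Each generation refines time by `4` and every space coordinate by `2`, hence the growth rate `4
· 2^d = 2^(d+2)`. -/
lemma card_gridBox_le (n : ℕ) :
    (gridBox d T N n).card ≤ ((⌈T⌉₊ + 1) * (2 * ⌈N⌉₊ + 1) ^ d) * (4 * 2 ^ d) ^ n := by
  rw [gridBox, Finset.card_product, Fintype.card_piFinset_const, Int.card_Icc, Int.card_Icc]
  have h1 : (⌈T⌉₊ * 4 ^ n + 1 - 0 : ℤ).toNat ≤ (⌈T⌉₊ + 1) * 4 ^ n := by
    have h : 1 ≤ 4 ^ n := Nat.one_le_pow _ _ (by norm_num)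
    zify at h
    rw [Int.toNat_le]
    push_cast
    linarith
  have h2 : (⌈N⌉₊ * 2 ^ n + 1 - -(⌈N⌉₊ * 2 ^ n) : ℤ).toNat ≤ (2 * ⌈N⌉₊ + 1) * 2 ^ n := by
    have h : 1 ≤ 2 ^ n := Nat.one_le_pow _ _ (by norm_num)
    zify at h
    rw [Int.toNat_le]
    push_cast
    linarith
  refine (Nat.mul_le_mul h1 (Nat.pow_le_pow_left h2 d)).trans_eq ?_
  rw [mul_pow, mul_pow, ← pow_mul, ← pow_mul, mul_comm n d]
  ring

lemma finite_gridProj_image (n : ℕ) : (gridProj n '' cylinder d T N).Finite :=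
  ((gridBox d T N n).finite_toSet.image (gridPoint d n)).subset <| by
    rintro _ ⟨X, hX, rfl⟩
    exact ⟨gridIndex n X, gridIndex_mem_gridBox n hX, rfl⟩

/-- The dyadic net of generation `n` of the cylinder. -/
def net (d : ℕ) (T N : ℝ) (n : ℕ) : Finset (SpaceTime d) :=
  (finite_gridProj_image (d := d) (T := T) (N := N) n).toFinset

lemma gridProj_mem_net (n : ℕ) {X : SpaceTime d} (hX : X ∈ cylinder d T N) :
    gridProj n X ∈ net d T N n := by
  simpa [net] using mem_image_of_mem (gridProj n) hX

lemma net_subset_cylinder (n : ℕ) {X : SpaceTime d} (hX : X ∈ net d T N n) :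
    X ∈ cylinder d T (N + d) := by
  rw [net, Finite.mem_toFinset] at hX
  obtain ⟨Y, hY, rfl⟩ := hX
  exact gridProj_mem_cylinder n hY

lemma card_net_le (n : ℕ) :
    (net d T N n).card ≤ ((⌈T⌉₊ + 1) * (2 * ⌈N⌉₊ + 1) ^ d) * (4 * 2 ^ d) ^ n := by
  classical
  refine le_trans ?_ (card_gridBox_le n)
  refine (Finset.card_le_card ?_).trans (Finset.card_image_le (f := gridPoint d n))
  intro X hX
  rw [net, Finite.mem_toFinset] at hX
  obtain ⟨Y, hY, rfl⟩ := hX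
  exact Finset.mem_image.2 ⟨_, gridIndex_mem_gridBox n hY, rfl⟩

open Classical in
/-- The pairs of nearby net points of generations `n` and `n + 1`. -/
def netPairs (d : ℕ) (T N : ℝ) (n : ℕ) : Finset (SpaceTime d × SpaceTime d) :=
  ((net d T N n ∪ net d T N (n + 1)) ×ˢ (net d T N n ∪ net d T N (n + 1))).filter
    fun p => pdist p.1 p.2 ≤ (2 * d + 3) * (1 / 2) ^ n

/-- The constant in the bound for the number of pairs. -/
def netConst (d : ℕ) (T N : ℝ) : ℕ :=
  (2 * ((⌈T⌉₊ + 1) * (2 * ⌈N⌉₊ + 1) ^ d) * (4 * 2 ^ d)) ^ 2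

/-- The proximity condition is dropped and all pairs are counted. This doubles the exponential rate
to `2(d+2)`, at the sole cost of a higher moment. -/
lemma card_netPairs_le (n : ℕ) :
    (netPairs d T N n).card ≤ netConst d T N * ((4 * 2 ^ d) ^ 2) ^ n := by
  classical
  set c := (⌈T⌉₊ + 1) * (2 * ⌈N⌉₊ + 1) ^ d with hc
  set b := 4 * 2 ^ d with hb
  have hb1 : 1 ≤ b := by rw [hb]; have := Nat.one_le_two_pow (n := d); omega
  have hU : (net d T N n ∪ net d T N (n + 1)).card ≤ 2 * c * b * b ^ n := by
    refine (Finset.card_union_le _ _).trans ?_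
    have h1 := card_net_le (d := d) (T := T) (N := N) n
    have h2 := card_net_le (d := d) (T := T) (N := N) (n + 1)
    rw [← hc, ← hb] at h1 h2
    have h3 : c * b ^ n ≤ c * b ^ (n + 1) := by gcongr; omega
    calc _ ≤ c * b ^ (n + 1) + c * b ^ (n + 1) := by omega
      _ = _ := by ring
  refine (Finset.card_filter_le _ _).trans ?_
  rw [Finset.card_product]
  calc _ ≤ (2 * c * b * b ^ n) * (2 * c * b * b ^ n) := by gcongr
    _ = _ := by rw [netConst, ← hc, ← hb]; ring_nf

lemma mem_netPairs_succ (n : ℕ) {X : SpaceTime d} (hX : X ∈ cylinder d T N) :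
    (gridProj n X, gridProj (n + 1) X) ∈ netPairs d T N n := by
  classical
  simp only [netPairs, Finset.mem_filter, Finset.mem_product, Finset.mem_union]
  refine ⟨⟨Or.inl (gridProj_mem_net n hX), Or.inr (gridProj_mem_net (n + 1) hX)⟩, ?_⟩
  have h1 := pdist_gridProj_le n X
  have h2 := pdist_gridProj_le (n + 1) X
  have h3 := pdist_triangle (gridProj n X) X (gridProj (n + 1) X)
  rw [pdist_comm _ X] at h3
  rw [pow_succ] at h2
  have h4 : (0 : ℝ) < (1 / 2) ^ n := by positivity
  have h5 : (0 : ℝ) ≤ d := by positivity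
  nlinarith [mul_nonneg h5 h4.le]

/-- Two rounding errors of `(d+1) 2⁻ⁿ` plus the distance `2⁻ⁿ` give the constant `2d + 3` of
`netPairs`. -/
lemma mem_netPairs_of_pdist_le (n : ℕ) {X Y : SpaceTime d} (hX : X ∈ cylinder d T N)
    (hY : Y ∈ cylinder d T N) (h : pdist X Y ≤ (1 / 2) ^ n) :
    (gridProj n X, gridProj n Y) ∈ netPairs d T N n := by
  classical
  simp only [netPairs, Finset.mem_filter, Finset.mem_product, Finset.mem_union]
  refine ⟨⟨Or.inl (gridProj_mem_net n hX), Or.inl (gridProj_mem_net n hY)⟩, ?_⟩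
  have h1 := pdist_gridProj_le n X
  have h2 := pdist_gridProj_le n Y
  have h3 := pdist_triangle (gridProj n X) X (gridProj n Y)
  have h4 := pdist_triangle X Y (gridProj n Y)
  rw [pdist_comm _ X] at h3
  linarith

end Nets

/-! ### The pathwise chaining estimate -/

section Chaining

variable {d : ℕ}

lemma half_rpow_pow_eq (κ : ℝ) (n : ℕ) :
    ENNReal.ofReal ((1 / 2) ^ κ) ^ n = ENNReal.ofReal (((1 / 2 : ℝ) ^ n) ^ κ) := by
  rw [← ENNReal.ofReal_pow (by positivity), ← Real.rpow_natCast, ← Real.rpow_mul (by norm_num),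
    ← Real.rpow_natCast, ← Real.rpow_mul (by norm_num), mul_comm]

/-- Summing the geometric increments bounds `f(π_n X) - w(X)` by a multiple of `2^(-nκ)`. Two points
at distance about `2⁻ⁿ` are compared through their projections of generation `n`. -/
lemma holderNorm_le_of_chaining {κ : ℝ} (hκ0 : 0 < κ) (hκ1 : κ ≤ 1) {S : Set (SpaceTime d)}
    {f w : SpaceTime d → ℝ} {π : ℕ → SpaceTime d → SpaceTime d} {G : ℝ≥0∞}
    (hsucc : ∀ X ∈ S, ∀ n, ‖f (π n X) - f (π (n + 1) X)‖ₑ ≤ G * ENNReal.ofReal ((1 / 2) ^ κ) ^ n)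
    (hnear : ∀ X ∈ S, ∀ Y ∈ S, ∀ n : ℕ, pdist X Y ≤ (1 / 2) ^ n →
      ‖f (π n X) - f (π n Y)‖ₑ ≤ G * ENNReal.ofReal ((1 / 2) ^ κ) ^ n)
    (hzero : ∀ X ∈ S, ‖f (π 0 X)‖ₑ ≤ G)
    (hlim : ∀ X ∈ S, Tendsto (fun n => f (π n X)) atTop (𝓝 (w X))) :
    holderNorm κ S w ≤ 8 * (1 - ENNReal.ofReal ((1 / 2) ^ κ))⁻¹ * G := by
  set q := ENNReal.ofReal ((1 / 2) ^ κ) with hq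
  set s := (1 - q)⁻¹ with hs
  have hs1 : 1 ≤ s := by
    rw [hs, ENNReal.one_le_inv]; exact tsub_le_self
  have htail : ∀ X ∈ S, ∀ n, ‖f (π n X) - w X‖ₑ ≤ s * G * q ^ n := by
    intro X hX n
    have h := edist_le_tsum_of_edist_le_of_tendsto (f := fun n => f (π n X)) (fun n => G * q ^ n)
      (fun n => by rw [edist_eq_enorm_sub]; exact hsucc X hX n) (hlim X hX) n
    rw [edist_eq_enorm_sub] at h
    refine h.trans (le_of_eq ?_)
    simp only [pow_add, ← mul_assoc]
    rw [ENNReal.tsum_mul_left, ENNReal.tsum_geometric]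
    ring
  have hGs : G ≤ s * G := le_mul_of_one_le_left zero_le hs1
  have hsup : ∀ X ∈ S, ‖w X‖ₑ ≤ 2 * (s * G) := by
    intro X hX
    have h1 := htail X hX 0
    rw [pow_zero, mul_one] at h1
    calc ‖w X‖ₑ = ‖f (π 0 X) - (f (π 0 X) - w X)‖ₑ := by congr 1; ring
      _ ≤ ‖f (π 0 X)‖ₑ + ‖f (π 0 X) - w X‖ₑ := enorm_sub_le
      _ ≤ s * G + s * G := add_le_add ((hzero X hX).trans hGs) h1
      _ = _ := by ring
  have hhol : holderSeminorm κ S w ≤ 6 * (s * G) := by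
    refine holderSeminorm_le fun X hX Y hY => ?_
    by_cases hXY : X = Y
    · simp [hXY]
    have hpos := pdist_pos hXY
    rcases le_or_gt 1 (pdist X Y) with h1 | h1
    · calc ‖w X - w Y‖ₑ ≤ ‖w X‖ₑ + ‖w Y‖ₑ := enorm_sub_le
        _ ≤ 2 * (s * G) + 2 * (s * G) := add_le_add (hsup X hX) (hsup Y hY)
        _ = 4 * (s * G) * 1 := by ring
        _ ≤ 6 * (s * G) * ENNReal.ofReal (pdist X Y ^ κ) := by
          gcongr
          · norm_num
          · rw [ENNReal.one_le_ofReal]; exact Real.one_le_rpow h1 hκ0.le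
    -- The scale satisfies `2^(-n-1) < δ(X,Y) ≤ 2⁻ⁿ`: the upper bound gives `hnear`, and the lower
    -- one, with `κ ≤ 1`, gives `q^n ≤ 2 δ^κ`.
    · obtain ⟨n, hn1, hn2⟩ := exists_nat_pow_near_of_lt_one hpos h1.le
        (by norm_num : (0 : ℝ) < 1 / 2) (by norm_num)
      have hqn : q ^ n ≤ 2 * ENNReal.ofReal (pdist X Y ^ κ) := by
        rw [hq, half_rpow_pow_eq, ← ENNReal.ofReal_ofNat, ← ENNReal.ofReal_mul (by norm_num)]
        refine ENNReal.ofReal_le_ofReal ?_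
        rw [pow_succ] at hn1
        calc ((1 / 2 : ℝ) ^ n) ^ κ ≤ (2 * pdist X Y) ^ κ := by
              gcongr; linarith
          _ = 2 ^ κ * pdist X Y ^ κ := Real.mul_rpow (by norm_num) hpos.le
          _ ≤ 2 ^ (1 : ℝ) * pdist X Y ^ κ := by
              gcongr
              norm_num
          _ = 2 * pdist X Y ^ κ := by norm_num
      calc ‖w X - w Y‖ₑ
          = ‖(f (π n X) - f (π n Y)) - (f (π n X) - w X) + (f (π n Y) - w Y)‖ₑ := by
            congr 1; ring
        _ ≤ ‖f (π n X) - f (π n Y)‖ₑ + ‖f (π n X) - w X‖ₑ + ‖f (π n Y) - w Y‖ₑ :=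
            (enorm_add_le _ _).trans (add_le_add enorm_sub_le le_rfl)
        _ ≤ s * G * q ^ n + s * G * q ^ n + s * G * q ^ n := by
            refine add_le_add (add_le_add ((hnear X hX Y hY n hn2).trans ?_) (htail X hX n))
              (htail Y hY n)
            gcongr
        _ = 3 * (s * G) * q ^ n := by ring
        _ ≤ 3 * (s * G) * (2 * ENNReal.ofReal (pdist X Y ^ κ)) := by gcongr
        _ = _ := by ring
  calc holderNorm κ S w ≤ 2 * (s * G) + 6 * (s * G) := add_le_add (iSup₂_le hsup) hhol
    _ = _ := by ring

lemma half_rpow_lt_one {κ : ℝ} (hκ0 : 0 < κ) : ENNReal.ofReal ((1 / 2) ^ κ) < 1 := by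
  rw [ENNReal.ofReal_lt_one]
  exact Real.rpow_lt_one (by norm_num) (by norm_num) hκ0

lemma one_sub_half_rpow_inv_lt_top {κ : ℝ} (hκ0 : 0 < κ) :
    (1 - ENNReal.ofReal ((1 / 2) ^ κ))⁻¹ < ∞ := by
  rw [ENNReal.inv_lt_top]
  exact tsub_pos_of_lt (half_rpow_lt_one hκ0)

lemma exists_tendsto_of_geometric {κ : ℝ} (hκ0 : 0 < κ) {x : ℕ → ℝ} {G : ℝ≥0∞} (hG : G ≠ ∞)
    (h : ∀ n, ‖x n - x (n + 1)‖ₑ ≤ G * ENNReal.ofReal ((1 / 2) ^ κ) ^ n) :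
    ∃ a, Tendsto x atTop (𝓝 a) := by
  refine cauchySeq_tendsto_of_complete (cauchySeq_of_edist_le_of_tsum_ne_top
    (fun n => G * ENNReal.ofReal ((1 / 2) ^ κ) ^ n)
    (fun n => by rw [edist_eq_enorm_sub]; exact h n) ?_)
  rw [ENNReal.tsum_mul_left, ENNReal.tsum_geometric]
  exact ENNReal.mul_ne_top hG (one_sub_half_rpow_inv_lt_top hκ0).ne

end Chaining

/-! ### Measurability of the Hölder norm -/

section MeasurableNorm

variable {d : ℕ} {F : Type*} [NormedAddCommGroup F]

lemma holderNorm_mono {κ : ℝ} {S S' : Set (SpaceTime d)} (h : S ⊆ S') (f : SpaceTime d → F) :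
    holderNorm κ S f ≤ holderNorm κ S' f :=
  add_le_add (biSup_mono h) (holderSeminorm_le fun _ hX _ hY =>
    enorm_sub_le_holderSeminorm f (h hX) (h hY))

/-- For a continuous function the suprema over `S` can be taken over a dense subset; a countable one
makes the norm of a random field measurable. -/
lemma holderNorm_eq_of_dense {κ : ℝ} (hκ : 0 < κ) {S t : Set (SpaceTime d)} (htS : t ⊆ S)
    (hSt : S ⊆ closure t) {f : SpaceTime d → F} (hf : ContinuousOn f S) :
    holderNorm κ S f = holderNorm κ t f := by
  refine le_antisymm ?_ (holderNorm_mono htS f)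
  have hlim : ∀ X ∈ S, Tendsto f (𝓝[t] X) (𝓝 (f X)) := fun X hX => (hf X hX).mono_left
    (nhdsWithin_mono _ htS)
  have hne : ∀ X ∈ S, (𝓝[t] X).NeBot := fun X hX => mem_closure_iff_nhdsWithin_neBot.1 (hSt hX)
  refine add_le_add (iSup₂_le fun X hX => ?_) ?_
  · have := hne X hX
    refine le_of_tendsto (hlim X hX).enorm ?_
    filter_upwards [self_mem_nhdsWithin] with Y hY
    exact le_iSup₂ (f := fun X (_ : X ∈ t) => ‖f X‖ₑ) Y hY
  -- The limit argument multiplies by the seminorm, which is continuous only if the seminorm is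
  -- finite.
  · by_cases hc : holderSeminorm κ t f = ∞
    · rw [hc]; exact le_top
    refine holderSeminorm_le fun X hX Y hY => ?_
    have := hne X hX
    have := hne Y hY
    have h1 : Tendsto (fun p : SpaceTime d × SpaceTime d => ‖f p.1 - f p.2‖ₑ)
        (𝓝[t] X ×ˢ 𝓝[t] Y) (𝓝 ‖f X - f Y‖ₑ) :=
      (((hlim X hX).comp tendsto_fst).sub ((hlim Y hY).comp tendsto_snd)).enorm
    have h2 : Tendsto (fun p : SpaceTime d × SpaceTime d =>
        holderSeminorm κ t f * ENNReal.ofReal (pdist p.1 p.2 ^ κ))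
        (𝓝[t] X ×ˢ 𝓝[t] Y) (𝓝 (holderSeminorm κ t f * ENNReal.ofReal (pdist X Y ^ κ))) := by
      have h3 : Continuous fun p : SpaceTime d × SpaceTime d =>
          ENNReal.ofReal (pdist p.1 p.2 ^ κ) :=
        ENNReal.continuous_ofReal.comp (continuous_pdist.rpow_const fun _ => Or.inr hκ.le)
      have h4 : (𝓝[t] X ×ˢ 𝓝[t] Y) ≤ 𝓝 (X, Y) := by
        rw [nhds_prod_eq]
        exact Filter.prod_mono nhdsWithin_le_nhds nhdsWithin_le_nhds
      exact ENNReal.Tendsto.const_mul ((h3.tendsto (X, Y)).mono_left h4) (Or.inr hc)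
    refine le_of_tendsto_of_tendsto h1 h2 ?_
    filter_upwards [prod_mem_prod self_mem_nhdsWithin self_mem_nhdsWithin] with p hp
    exact enorm_sub_le_holderSeminorm f hp.1 hp.2

lemma aemeasurable_holderNorm {Ω : Type*} [MeasurableSpace Ω] {P : Measure Ω} {κ : ℝ}
    (hκ : 0 < κ) {S : Set (SpaceTime d)} {w : SpaceTime d → Ω → ℝ}
    (hw : ∀ X ∈ S, AEMeasurable (w X) P) (hc : ∀ ω, ContinuousOn (fun X => w X ω) S) :
    AEMeasurable (fun ω => holderNorm κ S fun X => w X ω) P := by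
  obtain ⟨t, htS, htc, hSt⟩ :=
    (TopologicalSpace.IsSeparable.of_separableSpace S).exists_countable_dense_subset
  simp only [fun ω => holderNorm_eq_of_dense hκ htS hSt (hc ω)]
  refine AEMeasurable.add ?_ ?_
  · exact AEMeasurable.biSup t htc fun X hX => (hw X (htS hX)).enorm
  · refine AEMeasurable.biSup t htc fun X hX => AEMeasurable.biSup t htc fun Y hY =>
      AEMeasurable.iSup fun _ => ?_
    exact ((hw X (htS hX)).sub (hw Y (htS hY))).enorm.div_const _

end MeasurableNorm

/-! ### The continuity theorem for random fields -/

section Continuity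

variable {d : ℕ} {T N : ℝ} {Ω : Type*}

/-- The `m`-th power of the random chaining bound. -/
def chainSum (T N κ m : ℝ) (u : SpaceTime d → Ω → ℝ) (ω : Ω) : ℝ≥0∞ :=
  (∑ X ∈ net d T N 0, ‖u X ω‖ₑ ^ m) +
    ∑' n, ∑ p ∈ netPairs d T N n,
      (‖u p.1 ω - u p.2 ω‖ₑ / ENNReal.ofReal ((1 / 2) ^ κ) ^ n) ^ m

/-- The constant in the moment bound for `chainSum`. -/
def chainMoment (d : ℕ) (T N κ γ m : ℝ) : ℝ≥0∞ :=
  (net d T N 0).card + ∑' n : ℕ, (netConst d T N * ((4 * 2 ^ d) ^ 2) ^ n : ℕ) *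
    (ENNReal.ofReal ((2 * d + 3) ^ γ) * ENNReal.ofReal ((1 / 2) ^ (γ - κ)) ^ n) ^ m

/-- The series is geometric with ratio `2^(2(d+2)) · 2^(-(γ-κ)m)`: the first factor counts pairs,
the second is the moment gain, and `hmκ` says that the gain wins. -/
lemma chainMoment_lt_top {κ γ m : ℝ} (hm : 0 < m) (hmκ : 2 * ((d : ℝ) + 2) < (γ - κ) * m) :
    chainMoment d T N κ γ m < ∞ := by
  refine ENNReal.add_lt_top.2 ⟨ENNReal.natCast_lt_top _, ?_⟩
  set q := ENNReal.ofReal ((1 / 2) ^ (γ - κ))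
  set c := ENNReal.ofReal ((2 * d + 3) ^ γ)
  have hterm (n : ℕ) : ((netConst d T N * ((4 * 2 ^ d) ^ 2) ^ n : ℕ) : ℝ≥0∞) * (c * q ^ n) ^ m
      = netConst d T N * c ^ m * (((4 * 2 ^ d) ^ 2 : ℕ) * q ^ m) ^ n := by
    have hq : (q ^ n) ^ m = (q ^ m) ^ n := by
      rw [← ENNReal.rpow_natCast q n, ← ENNReal.rpow_natCast (q ^ m) n, ← ENNReal.rpow_mul,
        ← ENNReal.rpow_mul, mul_comm m]
    rw [ENNReal.mul_rpow_of_nonneg _ _ hm.le, hq, mul_pow (_ : ℝ≥0∞) (q ^ m)]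
    push_cast
    ring
  simp only [hterm]
  rw [ENNReal.tsum_mul_left, ENNReal.tsum_geometric]
  refine ENNReal.mul_lt_top (ENNReal.mul_lt_top (ENNReal.natCast_lt_top _)
    (ENNReal.rpow_lt_top_of_nonneg hm.le ENNReal.ofReal_ne_top)) ?_
  rw [ENNReal.inv_lt_top]
  refine tsub_pos_of_lt ?_
  have hb : (((4 * 2 ^ d) ^ 2 : ℕ) : ℝ≥0∞) = ENNReal.ofReal (2 ^ (2 * ((d : ℝ) + 2))) := by
    rw [← ENNReal.ofReal_natCast]
    congr 1
    rw [show (2 : ℝ) * ((d : ℝ) + 2) = ((2 * (d + 2) : ℕ) : ℝ) by push_cast; ring,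
      Real.rpow_natCast]
    push_cast
    rw [mul_comm 2 (d + 2), pow_mul, pow_add]
    ring
  rw [hb, ENNReal.ofReal_rpow_of_nonneg (by positivity) hm.le, ← ENNReal.ofReal_mul (by positivity),
    ENNReal.ofReal_lt_one, ← Real.rpow_mul (by norm_num), one_div, Real.inv_rpow (by norm_num),
    ← div_eq_mul_inv, div_lt_one (by positivity)]
  exact Real.rpow_lt_rpow_of_exponent_lt (by norm_num) hmκ

/-- The random chaining bound dominates the increments over net pairs. -/
lemma enorm_sub_le_chainSum {κ m : ℝ} (hm : 0 < m) (u : SpaceTime d → Ω → ℝ) (ω : Ω) {n : ℕ}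
    {p : SpaceTime d × SpaceTime d} (hp : p ∈ netPairs d T N n) :
    ‖u p.1 ω - u p.2 ω‖ₑ ≤
      chainSum T N κ m u ω ^ (1 / m) * ENNReal.ofReal ((1 / 2) ^ κ) ^ n := by
  have hq0 : ENNReal.ofReal ((1 / 2) ^ κ) ^ n ≠ 0 := pow_ne_zero _ (by
    simp only [ne_eq, ENNReal.ofReal_eq_zero, not_le]; positivity)
  rw [← ENNReal.div_le_iff hq0 (ENNReal.pow_ne_top ENNReal.ofReal_ne_top), one_div m,
    ENNReal.le_rpow_inv_iff hm]
  refine le_trans ?_ le_add_self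
  refine le_trans ?_ (ENNReal.le_tsum n)
  exact Finset.single_le_sum (f := fun p : SpaceTime d × SpaceTime d =>
    (‖u p.1 ω - u p.2 ω‖ₑ / ENNReal.ofReal ((1 / 2) ^ κ) ^ n) ^ m) (fun _ _ => zero_le) hp

lemma enorm_le_chainSum {κ m : ℝ} (hm : 0 < m) (u : SpaceTime d → Ω → ℝ) (ω : Ω)
    {X : SpaceTime d} (hX : X ∈ net d T N 0) :
    ‖u X ω‖ₑ ≤ chainSum T N κ m u ω ^ (1 / m) := by
  rw [one_div, ENNReal.le_rpow_inv_iff hm]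
  refine le_trans ?_ le_self_add
  exact Finset.single_le_sum (f := fun X => ‖u X ω‖ₑ ^ m) (fun _ _ => zero_le) hX

open Classical in
/-- The modification obtained as the limit along dyadic approximations. -/
def chainLimit (T N κ m : ℝ) (u : SpaceTime d → Ω → ℝ) (X : SpaceTime d) (ω : Ω) : ℝ :=
  if chainSum T N κ m u ω < ∞ then limUnder atTop fun n => u (gridProj n X) ω else 0

lemma tendsto_chainLimit {κ m : ℝ} (hκ0 : 0 < κ) (hm : 0 < m) (u : SpaceTime d → Ω → ℝ) {ω : Ω}
    (hω : chainSum T N κ m u ω < ∞) {X : SpaceTime d} (hX : X ∈ cylinder d T N) :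
    Tendsto (fun n => u (gridProj n X) ω) atTop (𝓝 (chainLimit T N κ m u X ω)) := by
  rw [chainLimit, if_pos hω]
  refine tendsto_nhds_limUnder (exists_tendsto_of_geometric hκ0
    (G := chainSum T N κ m u ω ^ (1 / m)) (ENNReal.rpow_ne_top_of_nonneg (by positivity) hω.ne)
    fun n => ?_)
  exact enorm_sub_le_chainSum hm u ω (mem_netPairs_succ n hX)

lemma holderNorm_chainLimit_le {κ m : ℝ} (hκ0 : 0 < κ) (hκ1 : κ ≤ 1) (hm : 0 < m)
    (u : SpaceTime d → Ω → ℝ) (ω : Ω) {S : Set (SpaceTime d)} (hS : S ⊆ cylinder d T N) :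
    holderNorm κ S (fun X => chainLimit T N κ m u X ω)
      ≤ 8 * (1 - ENNReal.ofReal ((1 / 2) ^ κ))⁻¹ * chainSum T N κ m u ω ^ (1 / m) := by
  by_cases hω : chainSum T N κ m u ω < ∞
  · refine holderNorm_le_of_chaining hκ0 hκ1 (f := fun X => u X ω) (π := gridProj)
      (fun X hX n => enorm_sub_le_chainSum hm u ω (mem_netPairs_succ n (hS hX)))
      (fun X hX Y hY n h => enorm_sub_le_chainSum hm u ω
        (mem_netPairs_of_pdist_le n (hS hX) (hS hY) h))
      (fun X hX => enorm_le_chainSum hm u ω (gridProj_mem_net 0 (hS hX)))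
      (fun X hX => tendsto_chainLimit hκ0 hm u hω (hS hX))
  -- On the exceptional event the modification is zero by definition, so the bound holds for every
  -- `ω`.
  · simp only [chainLimit, if_neg hω]
    simp [holderNorm, holderSeminorm]

variable [MeasurableSpace Ω] {P : Measure Ω}

lemma mem_cylinder_of_mem_netPairs {n : ℕ} {p : SpaceTime d × SpaceTime d}
    (hp : p ∈ netPairs d T N n) : p.1 ∈ cylinder d T (N + d) ∧ p.2 ∈ cylinder d T (N + d) ∧
      pdist p.1 p.2 ≤ (2 * d + 3) * (1 / 2) ^ n := by
  classical
  simp only [netPairs, Finset.mem_filter, Finset.mem_product, Finset.mem_union] at hp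
  refine ⟨?_, ?_, hp.2⟩
  · exact hp.1.1.elim (net_subset_cylinder n) (net_subset_cylinder (n + 1))
  · exact hp.1.2.elim (net_subset_cylinder n) (net_subset_cylinder (n + 1))

lemma aemeasurable_netPairs_term {κ m : ℝ} {u : SpaceTime d → Ω → ℝ}
    (hu : ∀ X ∈ cylinder d T (N + d), AEStronglyMeasurable (u X) P) {n : ℕ}
    {p : SpaceTime d × SpaceTime d} (hp : p ∈ netPairs d T N n) :
    AEMeasurable (fun ω => (‖u p.1 ω - u p.2 ω‖ₑ / ENNReal.ofReal ((1 / 2) ^ κ) ^ n) ^ m) P :=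
  (((hu _ (mem_cylinder_of_mem_netPairs hp).1).sub
    (hu _ (mem_cylinder_of_mem_netPairs hp).2.1)).enorm.div_const _).pow_const m

lemma aemeasurable_netPairs_sum {κ m : ℝ} {u : SpaceTime d → Ω → ℝ}
    (hu : ∀ X ∈ cylinder d T (N + d), AEStronglyMeasurable (u X) P) (n : ℕ) :
    AEMeasurable (fun ω => ∑ p ∈ netPairs d T N n,
      (‖u p.1 ω - u p.2 ω‖ₑ / ENNReal.ofReal ((1 / 2) ^ κ) ^ n) ^ m) P :=
  Finset.aemeasurable_fun_sum _ fun _ hp => aemeasurable_netPairs_term hu hp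

lemma aemeasurable_chainSum {κ m : ℝ} {u : SpaceTime d → Ω → ℝ}
    (hu : ∀ X ∈ cylinder d T (N + d), AEStronglyMeasurable (u X) P) :
    AEMeasurable (chainSum T N κ m u) P :=
  AEMeasurable.add (Finset.aemeasurable_fun_sum _ fun X hX =>
      ((hu X (net_subset_cylinder 0 hX)).enorm).pow_const m)
    (AEMeasurable.tsum fun n => aemeasurable_netPairs_sum hu n)

lemma lintegral_rpow_le_of_eLpNorm_le {f : Ω → ℝ} {m : ℝ} (hm : 0 < m) {B : ℝ≥0∞}
    (h : eLpNorm f (ENNReal.ofReal m) P ≤ B) : ∫⁻ ω, ‖f ω‖ₑ ^ m ∂P ≤ B ^ m := by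
  rw [eLpNorm_eq_lintegral_rpow_enorm_toReal (by simpa using hm) (by simp),
    ENNReal.toReal_ofReal hm.le] at h
  calc ∫⁻ ω, ‖f ω‖ₑ ^ m ∂P = ((∫⁻ ω, ‖f ω‖ₑ ^ m ∂P) ^ (1 / m)) ^ m := by
        rw [← ENNReal.rpow_mul, one_div, inv_mul_cancel₀ hm.ne', ENNReal.rpow_one]
    _ ≤ B ^ m := ENNReal.rpow_le_rpow h hm.le

lemma lintegral_chainSum_le {κ γ m : ℝ} (hγ : 0 < γ) (hm : 0 < m) {u : SpaceTime d → Ω → ℝ}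
    {L : ℝ≥0∞} (hu : ∀ X ∈ cylinder d T (N + d), AEStronglyMeasurable (u X) P)
    (h1 : ∀ X ∈ cylinder d T (N + d), eLpNorm (u X) (ENNReal.ofReal m) P ≤ L)
    (h2 : ∀ X ∈ cylinder d T (N + d), ∀ Y ∈ cylinder d T (N + d),
      eLpNorm (fun ω => u X ω - u Y ω) (ENNReal.ofReal m) P ≤ L * ENNReal.ofReal (pdist X Y ^ γ)) :
    ∫⁻ ω, chainSum T N κ m u ω ∂P ≤ chainMoment d T N κ γ m * L ^ m := by
  classical
  unfold chainSum
  rw [lintegral_add_left' (Finset.aemeasurable_fun_sum _ fun X hX =>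
      ((hu X (net_subset_cylinder 0 hX)).enorm).pow_const m),
    lintegral_finsetSum' _ fun X hX => ((hu X (net_subset_cylinder 0 hX)).enorm).pow_const m,
    lintegral_tsum fun n => aemeasurable_netPairs_sum (κ := κ) (m := m) hu n,
    chainMoment, add_mul, ← ENNReal.tsum_mul_right]
  refine add_le_add ?_ (ENNReal.tsum_le_tsum fun n => ?_)
  · rw [← nsmul_eq_mul]
    exact Finset.sum_le_card_nsmul _ _ _ fun X hX =>
      lintegral_rpow_le_of_eLpNorm_le hm (h1 X (net_subset_cylinder 0 hX))
  · rw [lintegral_finsetSum' _ fun p hp => aemeasurable_netPairs_term hu hp]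
    set q := ENNReal.ofReal ((1 / 2) ^ κ)
    have hq0 : q ^ n ≠ 0 := pow_ne_zero _ (by
      simp only [q, ne_eq, ENNReal.ofReal_eq_zero, not_le]; positivity)
    have hqt : q ^ n ≠ ∞ := ENNReal.pow_ne_top ENNReal.ofReal_ne_top
    have hterm : ∀ p ∈ netPairs d T N n,
        ∫⁻ ω, (‖u p.1 ω - u p.2 ω‖ₑ / q ^ n) ^ m ∂P ≤
          (ENNReal.ofReal ((2 * d + 3) ^ γ) * ENNReal.ofReal ((1 / 2) ^ (γ - κ)) ^ n) ^ m
            * L ^ m := by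
      intro p hp
      have hdist : ENNReal.ofReal (pdist p.1 p.2 ^ γ) ≤ ENNReal.ofReal ((2 * d + 3) ^ γ) *
          ENNReal.ofReal ((1 / 2) ^ (γ - κ)) ^ n * q ^ n := by
        rw [half_rpow_pow_eq, half_rpow_pow_eq, mul_assoc, ← ENNReal.ofReal_mul (by positivity),
          ← ENNReal.ofReal_mul (by positivity), ← Real.rpow_add (by positivity), sub_add_cancel,
          ← Real.mul_rpow (by positivity) (by positivity)]
        exact ENNReal.ofReal_le_ofReal
          (Real.rpow_le_rpow (pdist_nonneg _ _) (mem_cylinder_of_mem_netPairs hp).2.2 hγ.le)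
      have h3 := lintegral_rpow_le_of_eLpNorm_le hm (h2 _ (mem_cylinder_of_mem_netPairs hp).1 _ (mem_cylinder_of_mem_netPairs hp).2.1)
      simp only [ENNReal.div_rpow_of_nonneg _ _ hm.le]
      simp only [div_eq_mul_inv]
      rw [lintegral_mul_const' _ _ (by
        rw [ENNReal.inv_ne_top]; exact (ENNReal.rpow_pos (pos_iff_ne_zero.2 hq0) hqt).ne'),
        ← div_eq_mul_inv]
      refine ENNReal.div_le_of_le_mul (h3.trans ?_)
      rw [← ENNReal.mul_rpow_of_nonneg _ _ hm.le, ← ENNReal.mul_rpow_of_nonneg _ _ hm.le]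
      refine ENNReal.rpow_le_rpow ?_ hm.le
      refine (mul_le_mul_right hdist L).trans_eq ?_
      ring_nf
    refine (Finset.sum_le_card_nsmul _ _ _ hterm).trans ?_
    rw [nsmul_eq_mul, mul_assoc]
    gcongr
    exact_mod_cast card_netPairs_le n

/-- Convergence in `L^m` yields an almost surely convergent subsequence, whose limit must agree with
the almost sure one. -/
lemma ae_eq_of_tendsto_of_eLpNorm_sub {m : ℝ≥0∞} (hm : m ≠ 0) {f : ℕ → Ω → ℝ} {g h : Ω → ℝ}
    (hf : ∀ n, AEStronglyMeasurable (f n) P) (hg : AEStronglyMeasurable g P)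
    (hfg : Tendsto (fun n => eLpNorm (f n - g) m P) atTop (𝓝 0))
    (hfh : ∀ᵐ ω ∂P, Tendsto (fun n => f n ω) atTop (𝓝 (h ω))) : h =ᵐ[P] g := by
  obtain ⟨ns, hns, hae⟩ :=
    (tendstoInMeasure_of_tendsto_eLpNorm hm hf hg hfg).exists_seq_tendsto_ae
  filter_upwards [hae, hfh] with ω h1 h2
  exact tendsto_nhds_unique (h2.comp hns.tendsto_atTop) h1

/-- The constant in the continuity theorem. -/
def chainConst (d : ℕ) (T N κ γ m : ℝ) : ℝ≥0∞ :=
  8 * (1 - ENNReal.ofReal ((1 / 2) ^ κ))⁻¹ * chainMoment d T N κ γ m ^ (1 / m)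

lemma chainConst_lt_top {κ γ m : ℝ} (hκ0 : 0 < κ) (hm : 0 < m)
    (hmκ : 2 * ((d : ℝ) + 2) < (γ - κ) * m) : chainConst d T N κ γ m < ∞ :=
  ENNReal.mul_lt_top (ENNReal.mul_lt_top (by norm_num) (one_sub_half_rpow_inv_lt_top hκ0))
    (ENNReal.rpow_lt_top_of_nonneg (by positivity) (chainMoment_lt_top hm hmκ).ne)

/-- **Kolmogorov's continuity theorem** in the parabolic distance: a random field with bounded
`m`-th moments whose increments are `γ`-Hölder in `L^m` has a modification with `κ`-Hölder paths
if `m` is large. -/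
theorem exists_holder_modification {κ γ m : ℝ} (hκ0 : 0 < κ) (hκ1 : κ ≤ 1) (hγ : 0 < γ)
    (hm : 0 < m) (hmκ : 2 * ((d : ℝ) + 2) < (γ - κ) * m) {u : SpaceTime d → Ω → ℝ}
    {L : ℝ≥0∞} (hL : L ≠ ∞)
    (hu : ∀ X ∈ cylinder d T (N + d), AEStronglyMeasurable (u X) P)
    (h1 : ∀ X ∈ cylinder d T (N + d), eLpNorm (u X) (ENNReal.ofReal m) P ≤ L)
    (h2 : ∀ X ∈ cylinder d T (N + d), ∀ Y ∈ cylinder d T (N + d),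
      eLpNorm (fun ω => u X ω - u Y ω) (ENNReal.ofReal m) P ≤ L * ENNReal.ofReal (pdist X Y ^ γ))
    {S : Set (SpaceTime d)} (hS : S ⊆ cylinder d T N) :
    ∃ w : SpaceTime d → Ω → ℝ, (∀ X ∈ S, w X =ᵐ[P] u X) ∧
      AEMeasurable (fun ω => holderNorm κ S fun X => w X ω) P ∧
      (∫⁻ ω, holderNorm κ S (fun X => w X ω) ^ m ∂P) ^ (1 / m)
        ≤ chainConst d T N κ γ m * L := by
  have hint := lintegral_chainSum_le (κ := κ) hγ hm hu h1 h2
  have hint_top : ∫⁻ ω, chainSum T N κ m u ω ∂P ≠ ∞ :=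
    (hint.trans_lt (ENNReal.mul_lt_top (chainMoment_lt_top hm hmκ)
      (ENNReal.rpow_lt_top_of_nonneg hm.le hL))).ne
  have hmeas : AEMeasurable (chainSum T N κ m u) P := aemeasurable_chainSum hu
  have hfin : ∀ᵐ ω ∂P, chainSum T N κ m u ω < ∞ := ae_lt_top' hmeas hint_top
  have hmod : ∀ X ∈ S, chainLimit T N κ m u X =ᵐ[P] u X := by
    intro X hX
    have hX' := hS hX
    have hcyl : cylinder d T N ⊆ cylinder d T (N + d) := fun Y hY =>
      ⟨hY.1, hY.2.1, hY.2.2.trans (le_add_of_nonneg_right (Nat.cast_nonneg d))⟩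
    -- Along the dyadic projections `u` tends to `u X` in `L^m` by the increment bound, and to
    -- `chainLimit` almost surely.
    refine ae_eq_of_tendsto_of_eLpNorm_sub (m := ENNReal.ofReal m) (by simpa using hm)
      (f := fun n => u (gridProj n X)) (fun n => hu _ (gridProj_mem_cylinder n hX'))
      (hu _ (hcyl hX')) ?_ ?_
    · have hlim : Tendsto (fun n => L * ENNReal.ofReal (pdist (gridProj n X) X ^ γ)) atTop
          (𝓝 0) := by
        have h3 : Tendsto (fun n => pdist (gridProj n X) X) atTop (𝓝 0) := by
          refine squeeze_zero (fun n => pdist_nonneg _ _)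
            (fun n => (pdist_comm _ _).trans_le (pdist_gridProj_le n X)) ?_
          simpa using (tendsto_pow_atTop_nhds_zero_of_lt_one (by norm_num : (0 : ℝ) ≤ 1 / 2)
            (by norm_num)).const_mul ((d : ℝ) + 1)
        have h4 := ENNReal.tendsto_ofReal (h3.rpow_const (Or.inr hγ.le))
        rw [Real.zero_rpow hγ.ne', ENNReal.ofReal_zero] at h4
        simpa using ENNReal.Tendsto.const_mul h4 (Or.inr hL)
      exact tendsto_of_tendsto_of_tendsto_of_le_of_le tendsto_const_nhds hlim
        (fun _ => zero_le) fun n => h2 _ (gridProj_mem_cylinder n hX') _ (hcyl hX')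
    · filter_upwards [hfin] with ω hω
      exact tendsto_chainLimit hκ0 hm u hω hX'
  refine ⟨chainLimit T N κ m u, hmod, ?_, ?_⟩
  · refine aemeasurable_holderNorm hκ0
      (fun X hX => ((hu X ?_).aemeasurable).congr (hmod X hX).symm) fun ω => ?_
    · have hY := hS hX
      exact ⟨hY.1, hY.2.1, hY.2.2.trans (le_add_of_nonneg_right (Nat.cast_nonneg d))⟩
    · by_cases hω : chainSum T N κ m u ω < ∞
      · have hle := holderNorm_chainLimit_le hκ0 hκ1 hm u ω hS
        refine continuousOn_of_enorm_sub_le hκ0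
          (c := holderNorm κ S fun X => chainLimit T N κ m u X ω) ?_ fun X hX Y hY => ?_
        · refine (hle.trans_lt (ENNReal.mul_lt_top (ENNReal.mul_lt_top (by norm_num)
            (one_sub_half_rpow_inv_lt_top hκ0))
            (ENNReal.rpow_lt_top_of_nonneg (by positivity) hω.ne))).ne
        · refine (enorm_sub_le_holderSeminorm (κ := κ)
            (fun X => chainLimit T N κ m u X ω) hX hY).trans ?_
          gcongr
          exact le_add_self
      · simp only [chainLimit, if_neg hω]
        exact continuousOn_const
  · set c := 8 * (1 - ENNReal.ofReal ((1 / 2) ^ κ))⁻¹ with hc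
    have hctop : c ≠ ∞ := (ENNReal.mul_lt_top (by norm_num) (one_sub_half_rpow_inv_lt_top hκ0)).ne
    calc (∫⁻ ω, holderNorm κ S (fun X => chainLimit T N κ m u X ω) ^ m ∂P) ^ (1 / m)
        ≤ (∫⁻ ω, c ^ m * chainSum T N κ m u ω ∂P) ^ (1 / m) := by
          refine ENNReal.rpow_le_rpow (lintegral_mono fun ω => ?_) (by positivity)
          refine (ENNReal.rpow_le_rpow (holderNorm_chainLimit_le hκ0 hκ1 hm u ω hS) hm.le).trans ?_
          rw [ENNReal.mul_rpow_of_nonneg _ _ hm.le, ← ENNReal.rpow_mul, one_div m,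
            inv_mul_cancel₀ hm.ne', ENNReal.rpow_one]
      _ ≤ (c ^ m * (chainMoment d T N κ γ m * L ^ m)) ^ (1 / m) := by
          rw [lintegral_const_mul' _ _ (ENNReal.rpow_ne_top_of_nonneg hm.le hctop)]
          gcongr
      _ = chainConst d T N κ γ m * L := by
          rw [ENNReal.mul_rpow_of_nonneg (c ^ m) _ (by positivity),
            ENNReal.mul_rpow_of_nonneg (chainMoment d T N κ γ m) _ (by positivity), ← ENNReal.rpow_mul, ← ENNReal.rpow_mul,
            mul_one_div_cancel hm.ne', ENNReal.rpow_one, ENNReal.rpow_one, chainConst,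
            ← hc, ← mul_assoc]

end Continuity

/-! ### Moments of the stochastic convolution -/

section Field

variable {d : ℕ} {K : ℝ → EuclideanSpace ℝ (Fin d) → ℝ} {g : SpaceTime d → ℝ}
  {T β γ₁ γ₂ γ : ℝ} {C₁ C₀ : ℝ≥0} {N : ℝ}
  {Ω : Type*} [MeasurableSpace Ω] {P : Measure Ω} {W : ℝ≥0 → Ω → ℝ}

theorem stochConvExists_of_mem_cylinder (hβ0 : 0 < β) (hβ1 : β < 1) (hN : 0 ≤ N)
    (hK : Measurable (Function.uncurry K)) (hKB : KernelBounds T β γ₁ γ₂ C₁ C₀ K)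
    (g0 : g (0, 0) = 0) (hgH : holderSeminorm β (halfSpace d) g < ∞)
    (hγ : 0 < γ) (h₁ : γ ≤ γ₁) (h₂ : γ ≤ γ₂) (h₃ : γ ≤ β) (hW : IsPreBrownianReal W P)
    {X : SpaceTime d} (hX : X ∈ cylinder d T N) : StochConvExists W P K g X := by
  set g' := (halfSpace d).indicator g with hg'
  have heq : EqOn g' g (halfSpace d) := fun Y hY => indicator_of_mem hY g
  have hm := measurable_indicator_of_holder hβ0 hgH
  have g0' : g' (0, 0) = 0 := (heq ⟨self_mem_Ici, trivial⟩).trans g0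
  have hgH' : holderSeminorm β (halfSpace d) g' < ∞ := by rwa [holderSeminorm_congr heq]
  constructor
  · filter_upwards [ae_integrable_kernel_mul hβ0 hβ1 hN hK hKB hm g0' hgH' hX.2.1.le hX.2.2,
      ae_restrict_mem measurableSet_Ioo] with r hr hr'
    refine hr.congr (.of_forall fun y => ?_)
    exact congrArg _ (heq (x := (r, X.2 - y)) ⟨hr'.1.le, trivial⟩)
  · refine isWienerIntegral_wienerIntegral hW ?_
    rw [← convIntegrand_indicator]
    refine ⟨aestronglyMeasurable_convIntegrand hK hm X _, ?_⟩
    refine (eLpNorm_convIntegrand_le hβ0 hβ1 hN hK hKB hm g0' hgH' hγ h₁ h₂ h₃ hX).trans_lt ?_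
    exact ENNReal.mul_lt_top (ENNReal.mul_lt_top integrandConst_lt_top hgH') ENNReal.ofReal_lt_top

/-- The constant in the moment estimates of the stochastic convolution. -/
def fieldConst (T β γ₁ γ₂ γ N : ℝ) (C₁ C₀ : ℝ≥0) (m : ℝ≥0∞) : ℝ≥0∞ :=
  gaussNorm m * integrandConst T β γ₁ γ₂ N C₁ C₀ * ENNReal.ofReal ((1 + 2 * N + √T) ^ γ)

lemma fieldConst_lt_top {m : ℝ≥0∞} (hm : m ≠ ∞) : fieldConst T β γ₁ γ₂ γ N C₁ C₀ m < ∞ :=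
  ENNReal.mul_lt_top (ENNReal.mul_lt_top (gaussNorm_lt_top hm) integrandConst_lt_top)
    ENNReal.ofReal_lt_top

theorem eLpNorm_stochConv_le (hβ0 : 0 < β) (hβ1 : β < 1) (hN : 0 ≤ N)
    (hK : Measurable (Function.uncurry K)) (hKB : KernelBounds T β γ₁ γ₂ C₁ C₀ K)
    (g0 : g (0, 0) = 0) (hgH : holderSeminorm β (halfSpace d) g < ∞)
    (hγ : 0 < γ) (h₁ : γ ≤ γ₁) (h₂ : γ ≤ γ₂) (h₃ : γ ≤ β) (hW : IsPreBrownianReal W P)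
    {m : ℝ≥0∞} (hm : m ≠ ∞) {X : SpaceTime d} (hX : X ∈ cylinder d T N) :
    eLpNorm (stochConv W P K g X) m P
      ≤ fieldConst T β γ₁ γ₂ γ N C₁ C₀ m * holderSeminorm β (halfSpace d) g := by
  have hex := stochConvExists_of_mem_cylinder hβ0 hβ1 hN hK hKB g0 hgH hγ h₁ h₂ h₃ hW hX
  have heq : EqOn ((halfSpace d).indicator g) g (halfSpace d) := fun Y hY => indicator_of_mem hY g
  have hle := eLpNorm_convIntegrand_le (g := (halfSpace d).indicator g) hβ0 hβ1 hN hK hKB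
    (measurable_indicator_of_holder hβ0 hgH) ((heq ⟨self_mem_Ici, trivial⟩).trans g0)
    (by rwa [holderSeminorm_congr heq]) hγ h₁ h₂ h₃ hX
  rw [convIntegrand_indicator, holderSeminorm_congr heq] at hle
  refine (hex.2.eLpNorm_le hW hm).trans ((mul_le_mul_right hle _).trans_eq ?_)
  rw [fieldConst]
  ring

theorem eLpNorm_stochConv_sub_le (hβ0 : 0 < β) (hβ1 : β < 1) (hN : 0 ≤ N)
    (hK : Measurable (Function.uncurry K)) (hKB : KernelBounds T β γ₁ γ₂ C₁ C₀ K)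
    (g0 : g (0, 0) = 0) (hgH : holderSeminorm β (halfSpace d) g < ∞)
    (hγ : 0 < γ) (h₁ : γ ≤ γ₁) (h₂ : γ ≤ γ₂) (h₃ : γ ≤ β) (hW : IsPreBrownianReal W P)
    {m : ℝ≥0∞} (hm : m ≠ ∞) {X Y : SpaceTime d} (hX : X ∈ cylinder d T N)
    (hY : Y ∈ cylinder d T N) :
    eLpNorm (fun ω => stochConv W P K g X ω - stochConv W P K g Y ω) m P
      ≤ fieldConst T β γ₁ γ₂ γ N C₁ C₀ m * holderSeminorm β (halfSpace d) g
        * ENNReal.ofReal (pdist X Y ^ γ) := by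
  have hexX := stochConvExists_of_mem_cylinder hβ0 hβ1 hN hK hKB g0 hgH hγ h₁ h₂ h₃ hW hX
  have hexY := stochConvExists_of_mem_cylinder hβ0 hβ1 hN hK hKB g0 hgH hγ h₁ h₂ h₃ hW hY
  have heq : EqOn ((halfSpace d).indicator g) g (halfSpace d) := fun Y hY => indicator_of_mem hY g
  have hle := eLpNorm_convIntegrand_sub_le (g := (halfSpace d).indicator g) hβ0 hβ1 hN hK hKB
    (measurable_indicator_of_holder hβ0 hgH) ((heq ⟨self_mem_Ici, trivial⟩).trans g0)
    (by rwa [holderSeminorm_congr heq]) hγ h₁ h₂ h₃ hX hY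
  rw [convIntegrand_indicator, convIntegrand_indicator, holderSeminorm_congr heq] at hle
  refine ((hexX.2.sub hW hexY.2).eLpNorm_le hW hm).trans ((mul_le_mul_right hle _).trans ?_)
  -- The increment bound does not produce this factor; being at least `1`, it lets `fieldConst`
  -- serve both estimates.
  have hR : 1 ≤ ENNReal.ofReal ((1 + 2 * N + √T) ^ γ) := by
    rw [ENNReal.one_le_ofReal]
    exact Real.one_le_rpow (by linarith [Real.sqrt_nonneg T]) hγ.le
  calc _ = gaussNorm m * integrandConst T β γ₁ γ₂ N C₁ C₀ * 1 * holderSeminorm β (halfSpace d) g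
        * ENNReal.ofReal (pdist X Y ^ γ) := by ring
    _ ≤ _ := by rw [fieldConst]; gcongr

end Field

lemma lrHolderNorm_le_of_exponent_le {d : ℕ} {Ω : Type*} [MeasurableSpace Ω] {P : Measure Ω}
    [IsProbabilityMeasure P] {r m κ : ℝ} (hr : 0 < r) (hrm : r ≤ m) {S : Set (SpaceTime d)}
    {w : SpaceTime d → Ω → ℝ} (hw : AEMeasurable (fun ω => holderNorm κ S fun X => w X ω) P) :
    lrHolderNorm P r κ S w ≤ lrHolderNorm P m κ S w := by
  have := eLpNorm'_le_eLpNorm'_of_exponent_le hr hrm P hw.aestronglyMeasurable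
  simpa only [lrHolderNorm, eLpNorm', enorm_eq_self] using this

end StochHolder

end

/-! ### The main theorem: choice of constants and assembly -/

theorem theorem3p2
    (d : ℕ) (hd : 1 ≤ d) (T : ℝ) (hT : 0 < T)
    -- the bounded `A`-type domain, with closure in `(0,T) × ℝ^d`
    (D : Set (SpaceTime d)) (hDo : IsOpen D) (hDc : IsConnected D)
    (hDb : Bornology.IsBounded D) (hDA : IsAType D)
    (hDT : closure D ⊆ Ioo 0 T ×ˢ univ)
    (β : ℝ) (hβ0 : 0 < β) (hβ1 : β < 1)
    (γ₁ γ₂ : ℝ) (hγ₁ : 0 < γ₁) (hγ₂ : 0 < γ₂) (C₁ C₀ : ℝ≥0)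
    -- the real exponent `p ≥ 1`
    (p : ℝ) [Fact (1 ≤ ENNReal.ofReal p)]
    (γ θ : ℝ) (hγ : γ = min (min γ₁ γ₂) β) (hθ : θ = 1 + γ * p / (d + 2)) :
    -- the constants: `C`, and `C' δ q r` for the pathwise estimate
    ∃ (C : ℝ≥0) (C' : ℝ → ℝ → ℝ → ℝ≥0),
      ∀ K : ℝ → EuclideanSpace ℝ (Fin d) → ℝ, Measurable (Function.uncurry K) →
      KernelBounds T β γ₁ γ₂ C₁ C₀ K →
      ∀ g : SpaceTime d → ℝ, g (0, 0) = 0 →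
      holderSeminorm β (Ici 0 ×ˢ univ) g < ∞ →
      ∀ (Ω : Type*) [MeasurableSpace Ω] (P : Measure Ω) [IsProbabilityMeasure P]
        (W : ℝ≥0 → Ω → ℝ), IsBrownianReal W P →
      -- `u = stochConv W P K g` is well defined on `D`
      (∀ X ∈ D, StochConvExists W P K g X) ∧
      -- `v` is `u` viewed as a function with values in `L^p(Ω)`
      (∃ v : SpaceTime d → Lp ℝ (ENNReal.ofReal p) P,
        (∀ X ∈ D, v X =ᵐ[P] stochConv W P K g X) ∧
        MemCampanato p θ D v ∧
        campanatoNorm p θ D v ≤ C * holderNorm β (Ici 0 ×ˢ univ) g ∧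
        ∀ κ : ℝ, 0 < κ → κ ≤ γ →
          holderNorm κ D v < ∞ ∧
          holderNorm κ D v ≤ C * holderNorm β (Ici 0 ×ˢ univ) g) ∧
      -- the pathwise estimate, for a modification `w` of `u`
      (∀ δ q r : ℝ, 0 < δ → δ < γ * p / 2 → (d + 2) / δ < q → 0 < r → r < q →
        ∃ w : SpaceTime d → Ω → ℝ,
          (∀ X ∈ D, w X =ᵐ[P] stochConv W P K g X) ∧
          AEMeasurable (fun ω => holderNorm (γ - 2 * δ / p) D (fun X => w X ω)) P ∧
          lrHolderNorm P r (γ - 2 * δ / p) D w < ∞ ∧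
          lrHolderNorm P r (γ - 2 * δ / p) D w
            ≤ C' δ q r * holderNorm β (Ici 0 ×ˢ univ) g) := by
  obtain ⟨A, hA, hDA⟩ := hDA
  obtain ⟨R₀, hR₀⟩ := hDb.exists_norm_le
  set N : ℝ := max R₀ 0
  have hN : 0 ≤ N := le_max_right _ _
  have hDcyl : D ⊆ cylinder d T N := fun X hX =>
    ⟨(hDT (subset_closure hX)).1.1.le, (hDT (subset_closure hX)).1.2,
      (norm_snd_le X).trans ((hR₀ X hX).trans (le_max_left _ _))⟩
  have hNd : 0 ≤ N + d := by positivity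
  have hcyl : cylinder d T N ⊆ cylinder d T (N + d) := fun Y hY =>
    ⟨hY.1, hY.2.1, hY.2.2.trans (le_add_of_nonneg_right (Nat.cast_nonneg d))⟩
  have hp : 1 ≤ p := ENNReal.one_le_ofReal.1 Fact.out
  have hp0 : 0 < p := by linarith
  have hγ0 : 0 < γ := by rw [hγ]; exact lt_min (lt_min hγ₁ hγ₂) hβ0
  have h₁ : γ ≤ γ₁ := by rw [hγ]; exact (min_le_left _ _).trans (min_le_left _ _)
  have h₂ : γ ≤ γ₂ := by rw [hγ]; exact (min_le_left _ _).trans (min_le_right _ _)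
  have h₃ : γ ≤ β := by rw [hγ]; exact min_le_right _ _
  have hvol : volume D ≠ ∞ := hDb.measure_lt_top.ne
  set R : ℝ := 1 + 2 * N + √T
  have hR1 : 1 ≤ R := by simp only [R]; linarith [Real.sqrt_nonneg T]
  have hDR : ∀ X ∈ D, ∀ Y ∈ D, pdist X Y ≤ R := fun X hX Y hY =>
    pdist_le_of_mem_cylinder (hDcyl hX) (hDcyl hY)
  set B : ℝ≥0∞ → ℝ≥0∞ := fieldConst T β γ₁ γ₂ γ (N + d) C₁ C₀ with hB
  have hBtop {m : ℝ≥0∞} (hm : m ≠ ∞) : B m ≠ ∞ := (fieldConst_lt_top hm).ne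
  have hcamp : (volume D + campanatoConst d p γ A) ^ (1 / p) ≠ ∞ :=
    ENNReal.rpow_ne_top_of_nonneg (by positivity)
      (ENNReal.add_ne_top.2 ⟨hvol, (campanatoConst_lt_top hA).ne⟩)
  -- The sum of the Campanato and Hölder factors, so that a single `C` dominates both norms.
  set Q : ℝ≥0∞ := (volume D + campanatoConst d p γ A) ^ (1 / p) + (1 + ENNReal.ofReal (R ^ γ))
    with hQ
  have hQtop : Q ≠ ∞ := by rw [hQ]; finiteness
  have hCtop : B (ENNReal.ofReal p) * Q ≠ ∞ := ENNReal.mul_ne_top (hBtop ENNReal.ofReal_ne_top) hQtop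
  -- Since `γ - κ = 2δ/p`, this gives `(γ-κ)m = (γ-κ) max(r,1) + 2(d+2)`, strictly above the
  -- chaining threshold; moreover `m ≥ r`.
  set m : ℝ → ℝ → ℝ := fun δ r => max r 1 + 2 * ((d : ℝ) + 2) / (2 * δ / p) with hm
  set C' : ℝ → ℝ → ℝ≥0∞ := fun δ r =>
    chainConst d T N (γ - 2 * δ / p) γ (m δ r) * B (ENNReal.ofReal (m δ r)) with hC'
  refine ⟨(B (ENNReal.ofReal p) * Q).toNNReal, fun δ _ r => (C' δ r).toNNReal, ?_⟩
  intro K hK hKB g g0 hgH Ω _ P _ W hW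
  have hW' := hW.toIsPreBrownianReal
  set H := holderSeminorm β (halfSpace d) g with hH
  have hHle : H ≤ holderNorm β (Ici 0 ×ˢ univ) g := le_add_self
  have hex : ∀ X ∈ cylinder d T (N + d), StochConvExists W P K g X := fun X hX =>
    stochConvExists_of_mem_cylinder hβ0 hβ1 hNd hK hKB g0 hgH hγ0 h₁ h₂ h₃ hW' hX
  have hsup {q : ℝ≥0∞} (hq : q ≠ ∞) : ∀ X ∈ cylinder d T (N + d),
      eLpNorm (stochConv W P K g X) q P ≤ B q * H := fun X hX =>
    eLpNorm_stochConv_le hβ0 hβ1 hNd hK hKB g0 hgH hγ0 h₁ h₂ h₃ hW' hq hX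
  have hinc {q : ℝ≥0∞} (hq : q ≠ ∞) : ∀ X ∈ cylinder d T (N + d), ∀ Y ∈ cylinder d T (N + d),
      eLpNorm (fun ω => stochConv W P K g X ω - stochConv W P K g Y ω) q P
        ≤ B q * H * ENNReal.ofReal (pdist X Y ^ γ) := fun X hX Y hY =>
    eLpNorm_stochConv_sub_le hβ0 hβ1 hNd hK hKB g0 hgH hγ0 h₁ h₂ h₃ hW' hq hX hY
  have hBH {q : ℝ≥0∞} (hq : q ≠ ∞) : B q * H ≠ ∞ := ENNReal.mul_ne_top (hBtop hq) hgH.ne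
  refine ⟨fun X hX => hex X (hcyl (hDcyl hX)), ?_, ?_⟩
  · have hpt : ENNReal.ofReal p ≠ ∞ := ENNReal.ofReal_ne_top
    have hmem : ∀ X ∈ D, MemLp (stochConv W P K g X) (ENNReal.ofReal p) P := fun X hX =>
      ⟨(hex X (hcyl (hDcyl hX))).2.2.1.1, (hsup hpt X (hcyl (hDcyl hX))).trans_lt (hBH hpt).lt_top⟩
    classical
    -- The value `0` off `D` is a default; the norms see `v` only on `D`.
    set v : SpaceTime d → Lp ℝ (ENNReal.ofReal p) P := fun X =>
      if h : X ∈ D then (hmem X h).toLp _ else 0 with hv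
    have hvX {X : SpaceTime d} (hX : X ∈ D) : v X = (hmem X hX).toLp _ := dif_pos hX
    have hv1 : ∀ X ∈ D, ‖v X‖ₑ ≤ B (ENNReal.ofReal p) * H := by
      intro X hX
      rw [hvX hX, Lp.enorm_toLp]
      exact hsup hpt X (hcyl (hDcyl hX))
    have hv2 : ∀ X ∈ D, ∀ Y ∈ D, ‖v X - v Y‖ₑ
        ≤ B (ENNReal.ofReal p) * H * ENNReal.ofReal (pdist X Y ^ γ) := by
      intro X hX Y hY
      rw [hvX hX, hvX hY, ← MemLp.toLp_sub, Lp.enorm_toLp]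
      exact hinc hpt X (hcyl (hDcyl hX)) Y (hcyl (hDcyl hY))
    have hC : B (ENNReal.ofReal p) * H * Q
        ≤ (B (ENNReal.ofReal p) * Q).toNNReal * holderNorm β (Ici 0 ×ˢ univ) g := by
      rw [ENNReal.coe_toNNReal hCtop, mul_right_comm]
      gcongr
    have hCfin : B (ENNReal.ofReal p) * H * Q < ∞ := ENNReal.mul_lt_top (hBH hpt).lt_top hQtop.lt_top
    have hcam : campanatoNorm p θ D v ≤ B (ENNReal.ofReal p) * H * Q := by
      rw [hθ]
      refine (campanatoNorm_le_of_bounds hγ0 hp hDo hvol hA hDA (hBH hpt) hv1 hv2).trans ?_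
      gcongr
      exact le_self_add
    refine ⟨v, fun X hX => ?_, ⟨?_, hcam.trans_lt hCfin⟩, hcam.trans hC, fun κ hκ0 hκγ => ?_⟩
    · rw [hvX hX]
      exact (hmem X hX).coeFn_toLp
    · exact (continuousOn_of_enorm_sub_le hγ0 (hBH hpt) hv2).aestronglyMeasurable hDo.measurableSet
    · have hle : holderNorm κ D v ≤ B (ENNReal.ofReal p) * H * Q := by
        refine (holderNorm_le_of_bounds hR1 hDR hκ0 hκγ hv1 hv2).trans ?_
        gcongr
        exact le_add_self
      exact ⟨hle.trans_lt hCfin, hle.trans hC⟩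
  · intro δ q r hδ hδγ _ hr _
    set κ := γ - 2 * δ / p with hκ
    have hδp : 0 < 2 * δ / p := by positivity
    have hκ0 : 0 < κ := by
      rw [hκ, sub_pos, div_lt_iff₀ hp0]
      linarith
    have hκ1 : κ ≤ 1 := by linarith
    have hrm : r ≤ m δ r := (le_max_left r 1).trans (le_add_of_nonneg_right (by positivity))
    have hm1 : 1 ≤ m δ r := (le_max_right r 1).trans (le_add_of_nonneg_right (by positivity))
    have hm0 : 0 < m δ r := by linarith
    have hmκ : 2 * ((d : ℝ) + 2) < (γ - κ) * m δ r := by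
      have h4 : (γ - κ) * m δ r = 2 * δ / p * max r 1 + 2 * ((d : ℝ) + 2) := by
        simp only [hκ, hm, sub_sub_cancel]
        rw [mul_add, mul_div_cancel₀ _ hδp.ne']
      rw [h4]
      exact lt_add_of_pos_left _ (mul_pos hδp (lt_max_of_lt_left hr))
    have hmt : ENNReal.ofReal (m δ r) ≠ ∞ := ENNReal.ofReal_ne_top
    obtain ⟨w, hwu, hwm, hw⟩ := exists_holder_modification hκ0 hκ1 hγ0 hm0 hmκ (hBH hmt)
      (fun X hX => (hex X hX).2.2.1.1) (hsup hmt) (hinc hmt) hDcyl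
    have hC'top : C' δ r ≠ ∞ :=
      ENNReal.mul_ne_top (chainConst_lt_top hκ0 hm0 hmκ).ne (hBtop hmt)
    have hle : lrHolderNorm P r κ D w ≤ C' δ r * H := by
      refine (lrHolderNorm_le_of_exponent_le hr hrm hwm).trans (hw.trans_eq ?_)
      rw [hC', mul_assoc]
    refine ⟨w, hwu, hwm, hle.trans_lt (ENNReal.mul_lt_top hC'top.lt_top hgH), hle.trans ?_⟩
    rw [ENNReal.coe_toNNReal hC'top]
    gcongr
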